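/- Let $R$ be the ring of algebraic integers in a number field $K$ and let $R^\times=R\setminus\{0\}$, regarded as a multiplicative semigroup. Let $\mathfrak T[R]$ be the universal C*-algebra generated by unitaries $u^x$ ($x\in R$), isometries $s_a$ ($a\in R^\times$) and projections $e_I$ ($I$ a non-zero ideal of $R$) subject to the relations (a) $u^xu^y=u^{x+y}$, $s_as_b=s_{ab}$, $s_au^x=u^{ax}s_a$; (b) $e_{I\cap J}=e_Ie_J$, $e_R=1$; (c) $s_ae_Is_a^*=e_{aI}$; (d) $u^xe_I=e_Iu^x$ if $x\in I$, and $e_Iu^xe_I=0$ if $x\notin I$. Let $\bar{\mathcal D}\subset\mathfrak T[R]$ be the C*-subalgebra generated by the projections $u^xe_Iu^{-x}$ ($x\in R$, $I$ a non-zero ideal); it is commutative, and we denote its Gelfand spectrum by $Y_R$ and by $d\mapsto\hat d$ the Gelfand isomorphism $\bar{\mathcal D}\to C(Y_R)$. The additive group $R$ acts on $C(Y_R)\cong\bar{\mathcal D}$ by the automorphisms $d\mapsto u^xd\,u^{-x}$; let $C(Y_R)\rtimes R$ be the crossed product, with canonical unitaries $v_x$. The semigroup $R^\times$ acts on $C(Y_R)\rtimes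 R$ by the endomorphisms determined by $\hat d\,v_x\mapsto (s_ads_a^*)^{\wedge}\,v_{ax}$ ($d\in\bar{\mathcal D}$, $x\in R$). Let $(C(Y_R)\rtimes R)\rtimes R^\times$ be the corresponding semigroup crossed product, with canonical isometries $w_a$. Here, for an action $\alpha$ of a semigroup $S$ with identity on a unital C*-algebra $A$ by (not necessarily unital) endomorphisms, the crossed product $A\rtimes S$ is the universal C*-algebra generated by the image of a unital *-homomorphism $i$ of $A$ and by isometries $w_s$ ($s\in S$) with $w_sw_t=w_{st}$ and $w_s\,i(a)\,w_s^*=i(\alpha_s(a))$; the images $i(a)$ are written $a$. Then $\mathfrak T[R]$ is canonically isomorphic to $(C(Y_R)\rtimes R)\rtimes R^\times$: there is a *-isomorphism $\Phi:\mathfrak T[R]\to(C(Y_R)\rtimes R)\rtimes R^\times$ with $\Phi(u^x)=v_x$ for all $x\in R$, $\Phi(s_a)=w_a$ for all $a\in R^\times$, and $\Phi(d)=\hat d$ for all $d\in\bar{\mathcal D}$ (in particular $\Phi(e_I)=\widehat{e_I}$ for every non-zero ideal $I$). -/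

import Mathlib

noncomputable section

/-! ## Universal C*-algebras given by generators and relations -/

/-- The free unital complex *-algebra on the set `X`: noncommutative polynomials in the letters
`x` (left summand) and `x*` (right summand). -/
def FreeStarAlg (X : Type*) : Type _ := FreeAlgebra ℂ (X ⊕ X)

namespace FreeStarAlg

variable {X : Type*}

instance : Ring (FreeStarAlg X) := inferInstanceAs (Ring (FreeAlgebra ℂ (X ⊕ X)))
instance : Algebra ℂ (FreeStarAlg X) := inferInstanceAs (Algebra ℂ (FreeAlgebra ℂ (X ⊕ X)))

/-- The letter `x`. -/
def of (x : X) : FreeStarAlg X := FreeAlgebra.ι ℂ (Sum.inl x)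

/-- The opposite algebra with complex scalars acting through complex conjugation; the involution
of `FreeStarAlg X` is an algebra homomorphism into it. -/
def ConjOp (X : Type*) : Type _ := (FreeAlgebra ℂ (X ⊕ X))ᵐᵒᵖ

instance : Ring (ConjOp X) := inferInstanceAs (Ring (FreeAlgebra ℂ (X ⊕ X))ᵐᵒᵖ)

instance : Algebra ℂ (ConjOp X) :=
  Algebra.compHom (FreeAlgebra ℂ (X ⊕ X))ᵐᵒᵖ (starRingEnd ℂ)

/-- Reverse words, exchange `x` and `x*`, conjugate the coefficients. -/
def starHom (X : Type*) : FreeAlgebra ℂ (X ⊕ X) →ₐ[ℂ] ConjOp X :=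
  FreeAlgebra.lift ℂ (fun y => (MulOpposite.op (FreeAlgebra.ι ℂ y.swap) : ConjOp X))

/-- The involution of the free *-algebra. -/
def starFun (a : FreeStarAlg X) : FreeStarAlg X := MulOpposite.unop (starHom X a)

theorem starFun_ι (y : X ⊕ X) :
    starFun (FreeAlgebra.ι ℂ y : FreeAlgebra ℂ (X ⊕ X)) = FreeAlgebra.ι ℂ y.swap := by
  have h : starHom X (FreeAlgebra.ι ℂ y) = (MulOpposite.op (FreeAlgebra.ι ℂ y.swap) : ConjOp X) :=
    FreeAlgebra.lift_ι_apply _ y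
  exact congrArg MulOpposite.unop h

theorem starFun_algebraMap (c : ℂ) :
    starFun (algebraMap ℂ (FreeStarAlg X) c) = algebraMap ℂ (FreeStarAlg X) (starRingEnd ℂ c) := by
  unfold starFun
  have : starHom X (algebraMap ℂ (FreeAlgebra ℂ (X ⊕ X)) c) = algebraMap ℂ (ConjOp X) c :=
    (starHom X).commutes c
  erw [this]
  rfl

theorem starFun_add (a b : FreeStarAlg X) : starFun (a + b) = starFun a + starFun b := by
  unfold starFun
  erw [map_add (starHom X)]
  rfl

theorem starFun_mul (a b : FreeStarAlg X) : starFun (a * b) = starFun b * starFun a := by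
  unfold starFun
  erw [map_mul (starHom X)]
  rfl

theorem induct {p : FreeStarAlg X → Prop} (h0 : ∀ c, p (algebraMap ℂ _ c))
    (h1 : ∀ y : X ⊕ X, p (FreeAlgebra.ι ℂ y : FreeAlgebra ℂ (X ⊕ X)))
    (h2 : ∀ a b, p a → p b → p (a * b)) (h3 : ∀ a b, p a → p b → p (a + b)) (a) : p a :=
  FreeAlgebra.induction ℂ (X ⊕ X) (motive := p) h0 h1 h2 h3 a

instance : StarRing (FreeStarAlg X) where
  star := starFun
  star_involutive a := by
    induction a using induct with
    | h0 c => simp [starFun_algebraMap]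
    | h1 y => erw [starFun_ι, starFun_ι, Sum.swap_swap]
    | h2 a b ha hb => simp [starFun_mul, ha, hb]
    | h3 a b ha hb => simp [starFun_add, ha, hb]
  star_mul := starFun_mul
  star_add := starFun_add

theorem star_algebraMap' (c : ℂ) :
    star (algebraMap ℂ (FreeStarAlg X) c) = algebraMap ℂ (FreeStarAlg X) (star c) :=
  starFun_algebraMap c

instance : StarModule ℂ (FreeStarAlg X) where
  star_smul c a := by
    rw [Algebra.smul_def, star_mul, star_algebraMap', Algebra.smul_def, Algebra.commutes]

theorem ι_inr (x : X) :
    (FreeAlgebra.ι ℂ (Sum.inr x) : FreeAlgebra ℂ (X ⊕ X)) = star (of x) :=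
  (starFun_ι (Sum.inl x)).symm

/-- Induction over the free *-algebra. -/
theorem induct' {p : FreeStarAlg X → Prop} (h0 : ∀ c, p (algebraMap ℂ _ c))
    (h1 : ∀ x, p (of x)) (hs : ∀ x, p (star (of x)))
    (h2 : ∀ a b, p a → p b → p (a * b)) (h3 : ∀ a b, p a → p b → p (a + b)) (a) : p a := by
  refine induct h0 (fun y => ?_) h2 h3 a
  cases y with
  | inl x => exact h1 x
  | inr x => rw [ι_inr]; exact hs x

/-- The unital *-homomorphism that extends a map on the generators. -/
def lift {B : Type*} [Ring B] [StarRing B] [Algebra ℂ B] [StarModule ℂ B] (g : X → B) :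
    FreeStarAlg X →⋆ₐ[ℂ] B :=
  { (FreeAlgebra.lift ℂ (Sum.elim g (fun x => star (g x))) : FreeAlgebra ℂ (X ⊕ X) →ₐ[ℂ] B) with
    map_star' := by
      set φ : FreeStarAlg X →ₐ[ℂ] B :=
        (FreeAlgebra.lift ℂ (Sum.elim g (fun x => star (g x))) : FreeAlgebra ℂ (X ⊕ X) →ₐ[ℂ] B)
        with hφ
      have e1 : ∀ x, φ (of x) = g x := fun x => by
        rw [hφ]; erw [FreeAlgebra.lift_ι_apply]; rfl
      have e2 : ∀ x, φ (star (of x)) = star (g x) := fun x => by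
        rw [hφ, ← ι_inr]; erw [FreeAlgebra.lift_ι_apply]; rfl
      intro a
      change φ (star a) = star (φ a)
      induction a using induct' with
      | h0 c => rw [star_algebraMap', AlgHom.commutes, AlgHom.commutes, algebraMap_star_comm]
      | h1 x => rw [e1, e2]
      | hs x => rw [star_star, e1, e2, star_star]
      | h2 a b ha hb => rw [star_mul, map_mul, map_mul, star_mul, ha, hb]
      | h3 a b ha hb => rw [star_add, map_add, map_add, star_add, ha, hb] }

theorem lift_of {B : Type*} [Ring B] [StarRing B] [Algebra ℂ B] [StarModule ℂ B] (g : X → B)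
    (x : X) : lift g (of x) = g x := by
  change (FreeAlgebra.lift ℂ (Sum.elim g (fun x => star (g x)))) (FreeAlgebra.ι ℂ (Sum.inl x)) = _
  rw [FreeAlgebra.lift_ι_apply]; rfl

end FreeStarAlg

/-- A C*-seminorm on a complex *-algebra. -/
structure IsCStarSeminorm {F : Type*} [Ring F] [StarRing F] [Algebra ℂ F] (p : Seminorm ℂ F) :
    Prop where
  mul_le : ∀ a b, p (a * b) ≤ p a * p b
  star_mul_self : ∀ a, p (star a * a) = p a ^ 2

namespace IsCStarSeminorm

variable {F : Type*} [Ring F] [StarRing F] [Algebra ℂ F] {p : Seminorm ℂ F}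

theorem le_star (h : IsCStarSeminorm p) (a : F) : p a ≤ p (star a) := by
  rcases (apply_nonneg p a).eq_or_lt with h0 | h0
  · rw [← h0]; exact apply_nonneg p _
  · have := (h.star_mul_self a).symm.trans_le (h.mul_le _ _)
    rw [sq] at this
    exact le_of_mul_le_mul_right this h0

theorem star_eq (h : IsCStarSeminorm p) (a : F) : p (star a) = p a :=
  le_antisymm (by simpa using h.le_star (star a)) (h.le_star a)

theorem map_one_le (h : IsCStarSeminorm p) : p 1 ≤ 1 := by
  have := h.star_mul_self 1
  simp only [star_one, mul_one] at this
  nlinarith [apply_nonneg p (1 : F)]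

theorem le_one_of_isometry (h : IsCStarSeminorm p) {a : F} (ha : p (star a * a - 1) = 0) :
    p a ≤ 1 := by
  have h1 : p (star a * a) ≤ p (star a * a - 1) + p 1 := by
    simpa using map_add_le_add p (star a * a - 1) 1
  have := h.map_one_le
  rw [h.star_mul_self] at h1
  nlinarith [apply_nonneg p a]

theorem le_one_of_projection (h : IsCStarSeminorm p) {a : F} (ha : p (star a - a) = 0)
    (ha' : p (a * a - a) = 0) : p a ≤ 1 := by
  have e : star a * a = (star a - a) * a + ((a * a - a) + a) := by noncomm_ring
  have h1 : p (star a * a) ≤ p ((star a - a) * a) + (p (a * a - a) + p a) := by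
    rw [e]
    exact (map_add_le_add p _ _).trans (by gcongr; exact map_add_le_add p _ _)
  have h2 : p ((star a - a) * a) ≤ 0 := (h.mul_le _ _).trans (by rw [ha]; simp)
  rw [h.star_mul_self] at h1
  nlinarith [apply_nonneg p a]

/-- A C*-seminorm on a C*-algebra is dominated by the norm. -/
theorem le_norm {A : Type*} [CStarAlgebra A] {q : Seminorm ℂ A} (h : IsCStarSeminorm q) (a : A) :
    q a ≤ ‖a‖ := by
  have hu : ∀ u : unitary A, q u ≤ 1 := fun u =>
    h.le_one_of_isometry (by rw [Unitary.coe_star_mul_self]; simp)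
  have hsa : ∀ b : A, IsSelfAdjoint b → ‖b‖ ≤ 1 → q b ≤ 1 := by
    intro b hb hb1
    let _ := CStarAlgebra.spectralOrder A
    have _ := CStarAlgebra.spectralOrderedRing A
    have hre := selfAdjoint.realPart_unitarySelfAddISMul (⟨b, hb⟩ : selfAdjoint A) hb1
    set u := selfAdjoint.unitarySelfAddISMul (⟨b, hb⟩ : selfAdjoint A) hb1
    have hre' : b = (2⁻¹ : ℝ) • ((u : A) + star (u : A)) := by
      have := congrArg (Subtype.val) hre
      rw [realPart_apply_coe] at this
      exact this.symm
    have hc : ∀ x : A, (2⁻¹ : ℝ) • x = (2⁻¹ : ℂ) • x := fun x => by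
      rw [← Complex.coe_smul]; norm_num
    rw [hre', hc, map_smul_eq_mul]
    have := map_add_le_add q (u : A) (star (u : A))
    have h1 := hu u
    have h2 := h.star_eq (u : A)
    norm_num
    linarith
  have hone : ∀ b : A, ‖b‖ ≤ 1 → q b ≤ 1 := by
    intro b hb
    have := hsa (star b * b) (IsSelfAdjoint.star_mul_self b)
      (by rw [CStarRing.norm_star_mul_self]; nlinarith [norm_nonneg b])
    rw [h.star_mul_self] at this
    nlinarith [apply_nonneg q b]
  rcases eq_or_ne a 0 with rfl | ha
  · simp
  · have hn : ‖a‖ ≠ 0 := norm_ne_zero_iff.mpr ha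
    have := hone (((‖a‖⁻¹ : ℝ) : ℂ) • a) (by rw [norm_smul]; simp [hn])
    rw [map_smul_eq_mul] at this
    simp only [Complex.norm_real, norm_inv, norm_norm] at this
    rwa [inv_mul_le_iff₀ (by positivity), mul_one] at this

/-- The pull-back of the norm along a (not necessarily unital) *-homomorphism. -/
def comap {B : Type*} [CStarAlgebra B] (φ : F →⋆ₙₐ[ℂ] B) : Seminorm ℂ F :=
  (normSeminorm ℂ B).comp ((φ : F →ₙₐ[ℂ] B) : F →ₗ[ℂ] B)

theorem comap_apply {B : Type*} [CStarAlgebra B] (φ : F →⋆ₙₐ[ℂ] B) (a : F) :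
    comap φ a = ‖φ a‖ := rfl

theorem isCStarSeminorm_comap {B : Type*} [CStarAlgebra B] (φ : F →⋆ₙₐ[ℂ] B) :
    IsCStarSeminorm (comap φ) where
  mul_le a b := by simp only [comap_apply, map_mul]; exact norm_mul_le _ _
  star_mul_self a := by
    simp only [comap_apply, map_mul, map_star]
    rw [CStarRing.norm_star_mul_self, sq]

end IsCStarSeminorm

/-- A presentation of a C*-algebra: a set `X` of generators and a set of relations between
noncommutative *-polynomials in them, such that the C*-seminorms compatible with the relations are
bounded on each generator. (This is the condition under which there is a universal C*-algebra.) -/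
structure CStarPresentation (X : Type*) where
  /-- `rel a b` is the relation `a = b`. -/
  rel : FreeStarAlg X → FreeStarAlg X → Prop
  bdd : ∀ x : X, ∃ M : ℝ, ∀ p : Seminorm ℂ (FreeStarAlg X), IsCStarSeminorm p →
    (∀ a b, rel a b → p (a - b) = 0) → p (FreeStarAlg.of x) ≤ M

namespace CStarPresentation

variable {X : Type*} (P : CStarPresentation X)

/-- The C*-seminorms on the free *-algebra that are compatible with the relations. -/
def Adm : Set (Seminorm ℂ (FreeStarAlg X)) :=
  {p | IsCStarSeminorm p ∧ ∀ a b, P.rel a b → p (a - b) = 0}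

theorem bddAbove (a : FreeStarAlg X) : ∃ M : ℝ, ∀ p ∈ P.Adm, p a ≤ M := by
  induction a using FreeStarAlg.induct' with
  | h0 c =>
    refine ⟨‖c‖, fun p hp => ?_⟩
    rw [Algebra.algebraMap_eq_smul_one, map_smul_eq_mul]
    exact mul_le_of_le_one_right (norm_nonneg c) hp.1.map_one_le
  | h1 x =>
    obtain ⟨M, hM⟩ := P.bdd x
    exact ⟨M, fun p hp => hM p hp.1 hp.2⟩
  | hs x =>
    obtain ⟨M, hM⟩ := P.bdd x
    exact ⟨M, fun p hp => (hp.1.star_eq _).trans_le (hM p hp.1 hp.2)⟩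
  | h2 a b ha hb =>
    obtain ⟨M, hM⟩ := ha
    obtain ⟨N, hN⟩ := hb
    refine ⟨M * N, fun p hp => (hp.1.mul_le a b).trans ?_⟩
    exact mul_le_mul (hM p hp) (hN p hp) (apply_nonneg p b) ((apply_nonneg p a).trans (hM p hp))
  | h3 a b ha hb =>
    obtain ⟨M, hM⟩ := ha
    obtain ⟨N, hN⟩ := hb
    exact ⟨M + N, fun p hp => (map_add_le_add p a b).trans (add_le_add (hM p hp) (hN p hp))⟩

/-- The universal C*-seminorm: the supremum of all C*-seminorms compatible with the relations. -/
def univNorm (a : FreeStarAlg X) : ℝ := ⨆ p : P.Adm, p.1 a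

theorem le_univNorm {p : Seminorm ℂ (FreeStarAlg X)} (hp : p ∈ P.Adm) (a : FreeStarAlg X) :
    p a ≤ P.univNorm a := by
  obtain ⟨M, hM⟩ := P.bddAbove a
  exact le_ciSup (f := fun p : P.Adm => p.1 a) ⟨M, by rintro _ ⟨q, rfl⟩; exact hM q.1 q.2⟩ ⟨p, hp⟩

instance : Nonempty P.Adm := ⟨⟨0, ⟨by simp, by simp⟩, by simp⟩⟩

theorem univNorm_le {a : FreeStarAlg X} {M : ℝ} (h : ∀ p ∈ P.Adm, p a ≤ M) : P.univNorm a ≤ M :=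
  ciSup_le fun p => h p.1 p.2

theorem univNorm_nonneg (a : FreeStarAlg X) : 0 ≤ P.univNorm a :=
  Real.iSup_nonneg fun p => apply_nonneg p.1 a

/-- The universal C*-seminorm as a seminorm. -/
def univSeminorm : Seminorm ℂ (FreeStarAlg X) :=
  Seminorm.of P.univNorm
    (fun a b => P.univNorm_le fun p hp => (map_add_le_add p a b).trans
      (add_le_add (P.le_univNorm hp a) (P.le_univNorm hp b)))
    (fun c a => by
      have h : ∀ (c : ℂ) (a : FreeStarAlg X), P.univNorm (c • a) ≤ ‖c‖ * P.univNorm a :=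
        fun c a => P.univNorm_le fun p hp => by
          rw [map_smul_eq_mul]
          exact mul_le_mul_of_nonneg_left (P.le_univNorm hp a) (norm_nonneg c)
      refine le_antisymm (h c a) ?_
      rcases eq_or_ne c 0 with rfl | hc
      · simpa using P.univNorm_nonneg _
      · have := h c⁻¹ (c • a)
        rw [smul_smul, inv_mul_cancel₀ hc, one_smul, norm_inv] at this
        rwa [le_inv_mul_iff₀ (norm_pos_iff.mpr hc)] at this)

theorem univSeminorm_apply (a : FreeStarAlg X) : P.univSeminorm a = P.univNorm a := rfl

theorem isCStarSeminorm_univSeminorm : IsCStarSeminorm P.univSeminorm where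
  mul_le a b := P.univNorm_le fun p hp => (hp.1.mul_le a b).trans
    (mul_le_mul (P.le_univNorm hp a) (P.le_univNorm hp b) (apply_nonneg p b)
      (P.univNorm_nonneg a))
  star_mul_self a := by
    simp only [univSeminorm_apply]
    refine le_antisymm (P.univNorm_le fun p hp => ?_) ?_
    · rw [hp.1.star_mul_self]
      exact pow_le_pow_left₀ (apply_nonneg p a) (P.le_univNorm hp a) 2
    · have h : P.univNorm a ≤ √(P.univNorm (star a * a)) := P.univNorm_le fun p hp => by
        refine Real.le_sqrt_of_sq_le ?_
        rw [← hp.1.star_mul_self]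
        exact P.le_univNorm hp _
      calc P.univNorm a ^ 2 ≤ √(P.univNorm (star a * a)) ^ 2 :=
            pow_le_pow_left₀ (P.univNorm_nonneg a) h 2
        _ = _ := Real.sq_sqrt (P.univNorm_nonneg _)

theorem univNorm_rel {a b : FreeStarAlg X} (h : P.rel a b) : P.univNorm (a - b) = 0 :=
  le_antisymm (P.univNorm_le fun _ hp => (hp.2 a b h).le) (P.univNorm_nonneg _)

/-- The free *-algebra, regarded as a seminormed algebra with the universal C*-seminorm. -/
def Pre (_P : CStarPresentation X) : Type _ := FreeStarAlg X

instance : Ring P.Pre := inferInstanceAs (Ring (FreeStarAlg X))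
instance : StarRing P.Pre := inferInstanceAs (StarRing (FreeStarAlg X))
instance : Algebra ℂ P.Pre := inferInstanceAs (Algebra ℂ (FreeStarAlg X))
instance : StarModule ℂ P.Pre := inferInstanceAs (StarModule ℂ (FreeStarAlg X))

instance : SeminormedRing P.Pre :=
  { (inferInstance : Ring P.Pre),
    P.univSeminorm.toAddGroupSeminorm.toSeminormedAddCommGroup with
    norm_mul_le := P.isCStarSeminorm_univSeminorm.mul_le }

theorem norm_def (a : P.Pre) : ‖a‖ = P.univNorm a := rfl

instance : NormedAlgebra ℂ P.Pre where
  norm_smul_le c a := (map_smul_eq_mul P.univSeminorm c a).le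

theorem norm_star (a : P.Pre) : ‖star a‖ = ‖a‖ := P.isCStarSeminorm_univSeminorm.star_eq a

instance : NormedStarGroup P.Pre := ⟨fun a => (P.norm_star a).le⟩

/-- The Hausdorff completion of the free *-algebra in the universal C*-seminorm. -/
def Compl : Type _ := UniformSpace.Completion P.Pre

instance : NormedRing P.Compl := inferInstanceAs (NormedRing (UniformSpace.Completion P.Pre))
instance : CompleteSpace P.Compl := inferInstanceAs (CompleteSpace (UniformSpace.Completion P.Pre))
instance : Algebra ℂ P.Compl := inferInstanceAs (Algebra ℂ (UniformSpace.Completion P.Pre))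
instance : NormedAlgebra ℂ P.Compl where
  norm_smul_le c a := norm_smul_le (α := ℂ) (β := UniformSpace.Completion P.Pre) c a

/-- The canonical map of the free *-algebra into the completion. -/
def coe (a : P.Pre) : P.Compl := UniformSpace.Completion.coe' a

theorem coe_add (a b : P.Pre) : P.coe (a + b) = P.coe a + P.coe b :=
  UniformSpace.Completion.coe_add a b
theorem coe_sub (a b : P.Pre) : P.coe (a - b) = P.coe a - P.coe b :=
  UniformSpace.Completion.coe_sub a b
theorem coe_mul (a b : P.Pre) : P.coe (a * b) = P.coe a * P.coe b :=
  UniformSpace.Completion.coe_mul a b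
theorem coe_one : P.coe 1 = 1 := UniformSpace.Completion.coe_one P.Pre
theorem coe_smul (c : ℂ) (a : P.Pre) : P.coe (c • a) = c • P.coe a :=
  UniformSpace.Completion.coe_smul c a
theorem norm_coe (a : P.Pre) : ‖P.coe a‖ = ‖a‖ := UniformSpace.Completion.norm_coe a
theorem continuous_coe : Continuous P.coe := UniformSpace.Completion.continuous_coe P.Pre
theorem denseRange_coe : DenseRange P.coe := UniformSpace.Completion.denseRange_coe

theorem uniformContinuous_star : UniformContinuous (star : P.Pre → P.Pre) :=
  (AddMonoidHomClass.isometry_of_norm (starAddEquiv : P.Pre ≃+ P.Pre)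
    P.norm_star).uniformContinuous

instance : Star P.Compl where
  star := (UniformSpace.Completion.map (star : P.Pre → P.Pre) :
    UniformSpace.Completion P.Pre → UniformSpace.Completion P.Pre)

theorem coe_star (a : P.Pre) : P.coe (star a) = star (P.coe a) :=
  (UniformSpace.Completion.map_coe P.uniformContinuous_star a).symm

theorem continuous_star' : Continuous (star : P.Compl → P.Compl) :=
  UniformSpace.Completion.continuous_map

theorem ind {p : P.Compl → Prop} (hc : IsClosed {a | p a}) (h : ∀ a : P.Pre, p (P.coe a)) (a) :
    p a :=
  P.denseRange_coe.induction_on a hc h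

instance : StarRing P.Compl where
  star_involutive a := by
    refine P.ind (p := fun a => star (star a) = a)
      (isClosed_eq (P.continuous_star'.comp P.continuous_star') continuous_id) (fun a => ?_) a
    rw [← coe_star, ← coe_star, star_star]
  star_mul a b := by
    refine P.denseRange_coe.induction_on₂ (p := fun a b => star (a * b) = star b * star a)
      (isClosed_eq (P.continuous_star'.comp (continuous_fst.mul continuous_snd))
        ((P.continuous_star'.comp continuous_snd).mul (P.continuous_star'.comp continuous_fst)))
      (fun a b => ?_) a b
    rw [← coe_mul, ← coe_star, ← coe_star, ← coe_star, star_mul, coe_mul]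
  star_add a b := by
    refine P.denseRange_coe.induction_on₂ (p := fun a b => star (a + b) = star a + star b)
      (isClosed_eq (P.continuous_star'.comp (continuous_fst.add continuous_snd))
        ((P.continuous_star'.comp continuous_fst).add (P.continuous_star'.comp continuous_snd)))
      (fun a b => ?_) a b
    rw [← coe_add, ← coe_star, ← coe_star, ← coe_star, star_add, coe_add]

instance : StarModule ℂ P.Compl where
  star_smul c a := by
    refine P.ind (p := fun a => star (c • a) = star c • star a)
      (isClosed_eq (P.continuous_star'.comp (continuous_const_smul c))
        ((continuous_const_smul (star c)).comp P.continuous_star')) (fun a => ?_) a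
    rw [← coe_smul, ← coe_star, ← coe_star, star_smul, coe_smul]

instance : CStarRing P.Compl where
  norm_mul_self_le a := by
    refine P.ind (p := fun a => ‖a‖ * ‖a‖ ≤ ‖star a * a‖)
      (isClosed_le (continuous_norm.mul continuous_norm)
        (continuous_norm.comp (P.continuous_star'.mul continuous_id))) (fun a => ?_) a
    rw [← coe_star, ← coe_mul, norm_coe, norm_coe, ← sq]
    exact (P.isCStarSeminorm_univSeminorm.star_mul_self a).ge

instance complCStarAlgebra : CStarAlgebra P.Compl where

/-- The canonical *-homomorphism of the free *-algebra into the completion. -/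
def toCompl : FreeStarAlg X →⋆ₐ[ℂ] P.Compl where
  toFun a := P.coe a
  map_one' := P.coe_one
  map_mul' := P.coe_mul
  map_zero' := UniformSpace.Completion.coe_zero
  map_add' := P.coe_add
  commutes' c := by
    rw [Algebra.algebraMap_eq_smul_one, Algebra.algebraMap_eq_smul_one]
    exact (P.coe_smul c 1).trans (by rw [P.coe_one])
  map_star' := P.coe_star

theorem toCompl_eq_of_rel {a b : FreeStarAlg X} (h : P.rel a b) : P.toCompl a = P.toCompl b := by
  rw [← sub_eq_zero, ← map_sub, ← norm_eq_zero]
  exact (P.norm_coe _).trans (P.univNorm_rel h)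

theorem continuous_starHom {A B : Type*} [CStarAlgebra A] [CStarAlgebra B] (φ : A →⋆ₙₐ[ℂ] B) :
    Continuous φ :=
  AddMonoidHomClass.continuous_of_bound φ 1 fun a => by
    rw [one_mul]; exact NonUnitalStarAlgHom.norm_apply_le φ a

section lift

variable {B : Type*} [CStarAlgebra B]

theorem norm_le_of_rel (φ : FreeStarAlg X →⋆ₙₐ[ℂ] B) (h : ∀ a b, P.rel a b → φ a = φ b)
    (a : FreeStarAlg X) : ‖φ a‖ ≤ P.univNorm a :=
  P.le_univNorm (p := IsCStarSeminorm.comap φ) ⟨IsCStarSeminorm.isCStarSeminorm_comap φ,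
    fun a b hab => by
      rw [IsCStarSeminorm.comap_apply, map_sub, h a b hab, sub_self, norm_zero]⟩ a

theorem exists_lift_compl (φ : FreeStarAlg X →⋆ₙₐ[ℂ] B) (h : ∀ a b, P.rel a b → φ a = φ b) :
    ∃ Φ : P.Compl →⋆ₙₐ[ℂ] B, ∀ a, Φ (P.toCompl a) = φ a := by
  let φ' : P.Pre →+ B := ((φ : FreeStarAlg X →ₙₐ[ℂ] B) : FreeStarAlg X →+ B)
  have hφ' : ∀ a : P.Pre, φ' a = φ a := fun _ => rfl
  have hu : UniformContinuous φ' :=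
    (AddMonoidHomClass.lipschitz_of_bound φ' 1 fun a => by
      rw [one_mul]; exact P.norm_le_of_rel φ h a).uniformContinuous
  let Ψ : P.Compl → B := UniformSpace.Completion.extension φ'
  have hc : Continuous Ψ := UniformSpace.Completion.continuous_extension
  have hΨ : ∀ a : P.Pre, Ψ (P.coe a) = φ' a := UniformSpace.Completion.extension_coe hu
  have hadd : ∀ a b, Ψ (a + b) = Ψ a + Ψ b := fun a b => by
    refine P.denseRange_coe.induction_on₂ (p := fun a b => Ψ (a + b) = Ψ a + Ψ b)
      (isClosed_eq (by fun_prop) (by fun_prop)) (fun a b => ?_) a b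
    rw [← coe_add, hΨ, hΨ, hΨ, map_add]
  have hmul : ∀ a b, Ψ (a * b) = Ψ a * Ψ b := fun a b => by
    refine P.denseRange_coe.induction_on₂ (p := fun a b => Ψ (a * b) = Ψ a * Ψ b)
      (isClosed_eq (by fun_prop) (by fun_prop)) (fun a b => ?_) a b
    rw [← coe_mul, hΨ, hΨ, hΨ]
    exact map_mul φ a b
  have hsmul : ∀ (c : ℂ) a, Ψ (c • a) = c • Ψ a := fun c a => by
    refine P.ind (p := fun a => Ψ (c • a) = c • Ψ a)
      (isClosed_eq (hc.comp (continuous_const_smul c)) (hc.const_smul c)) (fun a => ?_) a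
    rw [← coe_smul, hΨ, hΨ]
    exact map_smul φ c a
  have hstar : ∀ a, Ψ (star a) = star (Ψ a) := fun a => by
    refine P.ind (p := fun a => Ψ (star a) = star (Ψ a))
      (isClosed_eq (hc.comp P.continuous_star') (continuous_star.comp hc)) (fun a => ?_) a
    rw [← coe_star, hΨ, hΨ]
    exact map_star φ a
  have hzero : Ψ 0 = 0 := by simpa using hsmul 0 0
  exact ⟨
    { toFun := Ψ
      map_smul' := hsmul
      map_zero' := hzero
      map_add' := hadd
      map_mul' := hmul
      map_star' := hstar }, fun a => hΨ a⟩

theorem hom_ext_compl {Φ Ψ : P.Compl →⋆ₙₐ[ℂ] B} (h1 : Φ 1 = Ψ 1) (h : ∀ x, Φ (P.toCompl (FreeStarAlg.of x)) = Ψ (P.toCompl (FreeStarAlg.of x))) :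
    Φ = Ψ := by
  have hmk : ∀ a, Φ (P.toCompl a) = Ψ (P.toCompl a) := fun a => by
    induction a using FreeStarAlg.induct' with
    | h0 c =>
      rw [Algebra.algebraMap_eq_smul_one, map_smul, map_one, map_smul, map_smul, h1]
    | h1 x => exact h x
    | hs x => rw [map_star, map_star, map_star]; exact congrArg star (h x)
    | h2 a b ha hb => rw [map_mul, map_mul, map_mul, ha, hb]
    | h3 a b ha hb => rw [map_add, map_add, map_add, ha, hb]
  ext a
  exact P.ind (isClosed_eq (continuous_starHom Φ) (continuous_starHom Ψ)) hmk a

/-- The universal C*-algebra of a presentation: the Hausdorff completion of the free *-algebra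
in the universal C*-seminorm. -/
def CStar : Type _ := P.Compl

/-- The C*-algebra structure of the universal C*-algebra is that of the completion. (It is marked
irreducible only to keep elaboration fast.) -/
@[irreducible]
def cstarAlgebra : CStarAlgebra P.CStar :=
  P.complCStarAlgebra

instance : CStarAlgebra P.CStar := P.cstarAlgebra

/-- The identity map. -/
def complEquiv : P.Compl ≃⋆ₐ[ℂ] P.CStar where
  toFun a := a
  invFun a := a
  left_inv _ := rfl
  right_inv _ := rfl
  map_mul' _ _ := by with_unfolding_all rfl
  map_add' _ _ := by with_unfolding_all rfl
  map_star' _ := by with_unfolding_all rfl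
  map_smul' _ _ := by with_unfolding_all rfl

/-- The canonical *-homomorphism of the free *-algebra into the universal C*-algebra. -/
def toCStar : FreeStarAlg X →⋆ₐ[ℂ] P.CStar := (P.complEquiv : P.Compl →⋆ₐ[ℂ] P.CStar).comp P.toCompl

/-- The generators of the universal C*-algebra. -/
def gen (x : X) : P.CStar := P.toCStar (FreeStarAlg.of x)

theorem toCStar_eq_of_rel {a b : FreeStarAlg X} (h : P.rel a b) : P.toCStar a = P.toCStar b :=
  congrArg P.complEquiv (P.toCompl_eq_of_rel h)

/-- The universal property: a (not necessarily unital) *-homomorphism of the free *-algebra into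
a C*-algebra that respects the relations extends to the universal C*-algebra. -/
theorem exists_lift (φ : FreeStarAlg X →⋆ₙₐ[ℂ] B) (h : ∀ a b, P.rel a b → φ a = φ b) :
    ∃ Φ : P.CStar →⋆ₙₐ[ℂ] B, ∀ a, Φ (P.toCStar a) = φ a := by
  obtain ⟨Ψ, hΨ⟩ := P.exists_lift_compl φ h
  refine ⟨Ψ.comp (P.complEquiv.symm : P.CStar →⋆ₙₐ[ℂ] P.Compl), fun a => ?_⟩
  change Ψ (P.complEquiv.symm (P.complEquiv (P.toCompl a))) = φ a
  rw [StarAlgEquiv.symm_apply_apply, hΨ]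

/-- *-homomorphisms out of the universal C*-algebra are determined on the unit and the
generators. -/
theorem hom_ext {Φ Ψ : P.CStar →⋆ₙₐ[ℂ] B} (h1 : Φ 1 = Ψ 1) (h : ∀ x, Φ (P.gen x) = Ψ (P.gen x)) :
    Φ = Ψ := by
  have key : Φ.comp (P.complEquiv : P.Compl →⋆ₙₐ[ℂ] P.CStar) =
      Ψ.comp (P.complEquiv : P.Compl →⋆ₙₐ[ℂ] P.CStar) := by
    refine P.hom_ext_compl ?_ h
    change Φ (P.complEquiv 1) = Ψ (P.complEquiv 1)
    rw [map_one, h1]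
  ext z
  obtain ⟨y, rfl⟩ := P.complEquiv.surjective z
  exact DFunLike.congr_fun key y

end lift

end CStarPresentation

/-! ## Crossed products by semigroups of endomorphisms -/

/-- Generators of a crossed product: the elements of the algebra and those of the semigroup. -/
inductive CrossedGen (A S : Type*) : Type _
  | alg (a : A)
  | sgp (s : S)

namespace CrossedProduct

open FreeStarAlg

variable {A : Type*} [CStarAlgebra A] {S : Type*} [Monoid S]

/-- The relations of the crossed product of a unital C*-algebra `A` by an action `α` of the monoid
`S` by (not necessarily unital) endomorphisms: the `i a` form a unital *-homomorphism, the `v s` form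
a semigroup of isometries, and `(i, v)` is covariant, `v s * i a * (v s)* = i (α s a)`. -/
inductive Rel (α : S →* (A →⋆ₙₐ[ℂ] A)) :
    FreeStarAlg (CrossedGen A S) → FreeStarAlg (CrossedGen A S) → Prop
  | add (a b : A) : Rel α (of (.alg (a + b))) (of (.alg a) + of (.alg b))
  | smul (c : ℂ) (a : A) : Rel α (of (.alg (c • a))) (c • of (.alg a))
  | mul (a b : A) : Rel α (of (.alg (a * b))) (of (.alg a) * of (.alg b))
  | star (a : A) : Rel α (of (.alg (star a))) (star (of (.alg a)))
  | one : Rel α (of (.alg 1)) 1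
  | sgp_mul (s t : S) : Rel α (of (.sgp (s * t))) (of (.sgp s) * of (.sgp t))
  | isometry (s : S) : Rel α (Star.star (of (.sgp s)) * of (.sgp s)) 1
  | covariant (s : S) (a : A) :
      Rel α (of (.sgp s) * of (.alg a) * Star.star (of (.sgp s))) (of (.alg (α s a)))

theorem bdd_alg {α : S →* (A →⋆ₙₐ[ℂ] A)} {p : Seminorm ℂ (FreeStarAlg (CrossedGen A S))}
    (hp : IsCStarSeminorm p) (h : ∀ a b, Rel α a b → p (a - b) = 0) (a : A) :
    p (of (.alg a)) ≤ ‖a‖ := by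
  have key : ∀ x y, p (x - y) = 0 → p x = p y := fun x y hxy => by
    have := abs_sub_map_le_sub p x y
    rw [hxy] at this
    exact sub_eq_zero.mp (abs_nonpos_iff.mp this)
  let q : Seminorm ℂ A := Seminorm.of (fun a => p (of (.alg a)))
    (fun a b => by rw [key _ _ (h _ _ (Rel.add a b))]; exact map_add_le_add p _ _)
    (fun c a => by rw [key _ _ (h _ _ (Rel.smul c a)), map_smul_eq_mul])
  have hq : IsCStarSeminorm q :=
    { mul_le := fun a b => by
        change p (of (.alg (a * b))) ≤ p (of (.alg a)) * p (of (.alg b))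
        rw [key _ _ (h _ _ (Rel.mul a b))]
        exact hp.mul_le _ _
      star_mul_self := fun a => by
        change p (of (.alg (star a * a))) = p (of (.alg a)) ^ 2
        rw [key _ _ (h _ _ (Rel.mul _ a)), ← hp.star_mul_self]
        refine key _ _ (le_antisymm ?_ (apply_nonneg p _))
        rw [← sub_mul]
        refine (hp.mul_le _ _).trans ?_
        rw [h _ _ (Rel.star a), zero_mul] }
  exact hq.le_norm a

/-- The presentation of the crossed product. -/
def presentation (α : S →* (A →⋆ₙₐ[ℂ] A)) : CStarPresentation (CrossedGen A S) where
  rel := Rel α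
  bdd x := by
    cases x with
    | alg a => exact ⟨‖a‖, fun p hp h => bdd_alg hp h a⟩
    | sgp s => exact ⟨1, fun p hp h => hp.le_one_of_isometry (h _ _ (Rel.isometry s))⟩

end CrossedProduct

/-- The crossed product `A ⋊ S` of a unital C*-algebra `A` by an action `α` of the monoid `S` by
endomorphisms: the universal C*-algebra for covariant pairs. If `S` is a group, isometries forming a
representation of `S` are unitaries, and this is the usual (full) crossed product. -/
def CrossedProduct {A : Type*} [CStarAlgebra A] {S : Type*} [Monoid S]
    (α : S →* (A →⋆ₙₐ[ℂ] A)) : Type _ := (CrossedProduct.presentation α).CStar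

namespace CrossedProduct

open FreeStarAlg

variable {A : Type*} [CStarAlgebra A] {S : Type*} [Monoid S] (α : S →* (A →⋆ₙₐ[ℂ] A))

instance : CStarAlgebra (CrossedProduct α) :=
  inferInstanceAs (CStarAlgebra (presentation α).CStar)

/-- The canonical *-homomorphism `A → A ⋊ S`. -/
def i : A →⋆ₐ[ℂ] CrossedProduct α where
  toFun a := (presentation α).gen (.alg a)
  map_one' := ((presentation α).toCStar_eq_of_rel Rel.one).trans (map_one _)
  map_mul' a b := ((presentation α).toCStar_eq_of_rel (Rel.mul a b)).trans (map_mul _ _ _)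
  map_zero' := by
    have := ((presentation α).toCStar_eq_of_rel (Rel.smul 0 (0 : A)))
    rw [zero_smul, zero_smul, map_zero] at this
    exact this
  map_add' a b := ((presentation α).toCStar_eq_of_rel (Rel.add a b)).trans (map_add _ _ _)
  commutes' c := by
    have h1 := ((presentation α).toCStar_eq_of_rel (Rel.smul c (1 : A)))
    have h2 := ((presentation α).toCStar_eq_of_rel (Rel.one (α := α)))
    rw [map_smul, h2, map_one] at h1
    rw [Algebra.algebraMap_eq_smul_one, Algebra.algebraMap_eq_smul_one]
    exact h1
  map_star' a := ((presentation α).toCStar_eq_of_rel (Rel.star a)).trans (map_star _ _)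

/-- The canonical isometries `v s` in `A ⋊ S`. -/
def v (s : S) : CrossedProduct α := (presentation α).gen (.sgp s)

theorem v_mul (s t : S) : v α (s * t) = v α s * v α t :=
  ((presentation α).toCStar_eq_of_rel (Rel.sgp_mul s t)).trans (map_mul _ _ _)

theorem star_v_mul_v (s : S) : star (v α s) * v α s = 1 := by
  have := (presentation α).toCStar_eq_of_rel (Rel.isometry s)
  rw [map_mul, map_star, map_one] at this
  exact this

theorem v_one : v α 1 = 1 := by
  have h1 := star_v_mul_v α (1 : S)
  have h2 := v_mul α (1 : S) 1
  rw [mul_one] at h2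
  calc v α 1 = (star (v α 1) * v α 1) * v α 1 := by rw [h1, one_mul]
    _ = 1 := by rw [mul_assoc, ← h2, h1]

theorem covariant (s : S) (a : A) : v α s * i α a * star (v α s) = i α (α s a) := by
  have := (presentation α).toCStar_eq_of_rel (Rel.covariant (α := α) s a)
  rw [map_mul, map_mul, map_star] at this
  exact this

variable {α}

theorem hom_ext {B : Type*} [CStarAlgebra B] {Φ Ψ : CrossedProduct α →⋆ₙₐ[ℂ] B}
    (h1 : ∀ a, Φ (i α a) = Ψ (i α a)) (h2 : ∀ s, Φ (v α s) = Ψ (v α s)) : Φ = Ψ := by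
  refine (presentation α).hom_ext ?_ fun x => ?_
  · have := h1 1
    rwa [map_one] at this
  · cases x with
    | alg a => exact h1 a
    | sgp s => exact h2 s

/-- The universal property: a covariant pair consisting of a (not necessarily unital)
*-homomorphism `π` and elements `w s` of `B`, the latter being isometries that multiply like `S`
and commute with `π 1`, induces a *-homomorphism on the crossed product. -/
theorem exists_lift {B : Type*} [CStarAlgebra B] (π : A →⋆ₙₐ[ℂ] B) (w : S → B)
    (hmul : ∀ s t, w (s * t) = w s * w t) (hiso : ∀ s, star (w s) * w s = 1)
    (hcov : ∀ s a, w s * π a * star (w s) = π (α s a)) (hcomm : ∀ s, Commute (π 1) (w s)) :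
    ∃ Φ : CrossedProduct α →⋆ₙₐ[ℂ] B, (∀ a, Φ (i α a) = π a) ∧ ∀ s, Φ (v α s) = π 1 * w s := by
  have he : π 1 * π 1 = π 1 := by rw [← map_mul, one_mul]
  have hes : star (π 1) = π 1 := by rw [← map_star, star_one]
  have hl : ∀ a, π 1 * π a = π a := fun a => by rw [← map_mul, one_mul]
  have hr : ∀ a, π a * π 1 = π a := fun a => by rw [← map_mul, mul_one]
  let ψ : FreeStarAlg (CrossedGen A S) →⋆ₐ[ℂ] B := FreeStarAlg.lift fun x =>
    match x with
    | .alg a => π a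
    | .sgp s => w s
  have ψa : ∀ a, ψ (of (.alg a)) = π a := fun a => FreeStarAlg.lift_of _ _
  have ψs : ∀ s, ψ (of (.sgp s)) = w s := fun s => FreeStarAlg.lift_of _ _
  have hstar : ∀ z : B, Commute (π 1) z → Commute (π 1) (star z) := fun z hz => by
    have := hz.star_star
    rwa [hes] at this
  have hg : ∀ x, Commute (π 1) (ψ (of x)) := fun x => by
    cases x with
    | alg a => rw [ψa]; exact (hl a).trans (hr a).symm
    | sgp s => rw [ψs]; exact hcomm s
  have hc : ∀ z, Commute (π 1) (ψ z) := fun z => by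
    induction z using FreeStarAlg.induct' with
    | h0 c => rw [AlgHomClass.commutes]; exact (Algebra.commutes c _).symm
    | h1 x => exact hg x
    | hs x => rw [map_star]; exact hstar _ (hg x)
    | h2 a b ha hb => rw [map_mul]; exact ha.mul_right hb
    | h3 a b ha hb => rw [map_add]; exact ha.add_right hb
  let φ : FreeStarAlg (CrossedGen A S) →⋆ₙₐ[ℂ] B :=
    { toFun := fun z => π 1 * ψ z
      map_smul' := fun c z => by simp
      map_zero' := by simp
      map_add' := fun z z' => by rw [map_add, mul_add]
      map_mul' := fun z z' => by
        rw [map_mul, mul_assoc, ← mul_assoc (ψ z), ← (hc z).eq, mul_assoc, ← mul_assoc (π 1) (π 1),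
          he]
      map_star' := fun z => by
        rw [star_mul, hes, map_star, (hstar _ (hc z)).eq] }
  have hφ : ∀ z, φ z = π 1 * ψ z := fun _ => rfl
  obtain ⟨Φ, hΦ⟩ := (presentation α).exists_lift φ (by
    intro a b hab
    rw [hφ, hφ]
    cases hab with
    | add a b => rw [map_add, ψa, ψa, ψa, map_add]
    | smul c a => rw [map_smul, ψa, ψa, map_smul]
    | mul a b => rw [map_mul, ψa, ψa, ψa, map_mul]
    | star a => rw [map_star, ψa, ψa, map_star]
    | one => rw [ψa, map_one ψ, he, mul_one]
    | sgp_mul s t => rw [map_mul, ψs, ψs, ψs, hmul]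
    | isometry s => rw [map_mul, map_star, ψs, hiso, map_one ψ]
    | covariant s a => rw [map_mul, map_mul, map_star, ψs, ψa, ψa, hcov])
  refine ⟨Φ, fun a => ?_, fun s => ?_⟩
  · exact (hΦ _).trans (by rw [hφ, ψa, hl])
  · exact (hΦ _).trans (by rw [hφ, ψs])

section endo

variable {G : Type*} [Group G] {β : G →* (A →⋆ₙₐ[ℂ] A)}

theorem group_action_one (g : G) : β g 1 = 1 := by
  have h : β g (β g⁻¹ 1) = 1 := by
    change (β g * β g⁻¹) 1 = 1
    rw [← map_mul, mul_inv_cancel, map_one β]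
    rfl
  calc β g 1 = β g 1 * β g (β g⁻¹ 1) := by rw [h, mul_one]
    _ = 1 := by rw [← map_mul, one_mul, h]

theorem v_star (g : G) : star (v β g) = v β g⁻¹ := by
  have h1 : v β g * v β g⁻¹ = 1 := by rw [← v_mul, mul_inv_cancel, v_one]
  calc star (v β g) = star (v β g) * (v β g * v β g⁻¹) := by rw [h1, mul_one]
    _ = v β g⁻¹ := by rw [← mul_assoc, star_v_mul_v, one_mul]

/-- For an action `β` of a group `G` on `A`, an endomorphism `γ` of `A` that intertwines `β g` and
`β (θ g)` for an endomorphism `θ` of `G` extends to the endomorphism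
`i a * v g ↦ i (γ a) * v (θ g)` of the crossed product. -/
theorem exists_endo (γ : A →⋆ₙₐ[ℂ] A) (θ : G →* G) (h : ∀ g a, β (θ g) (γ a) = γ (β g a)) :
    ∃ Φ : CrossedProduct β →⋆ₙₐ[ℂ] CrossedProduct β,
      (∀ a, Φ (i β a) = i β (γ a)) ∧ ∀ g, Φ (v β g) = i β (γ 1) * v β (θ g) := by
  let π : A →⋆ₙₐ[ℂ] CrossedProduct β := ((i β : A →⋆ₙₐ[ℂ] CrossedProduct β)).comp γ
  refine exists_lift (α := β) π (fun g => v β (θ g)) (fun s t => by rw [map_mul, v_mul])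
    (fun s => star_v_mul_v β _)
    (fun s a => (covariant β _ _).trans (congrArg (i β) (h s a))) (fun s => ?_)
  have h1 := covariant β (θ s) (γ 1)
  rw [h, group_action_one, v_star] at h1
  change i β (γ 1) * v β (θ s) = v β (θ s) * i β (γ 1)
  calc i β (γ 1) * v β (θ s) = v β (θ s) * i β (γ 1) * v β (θ s)⁻¹ * v β (θ s) := by rw [h1]
    _ = _ := by rw [mul_assoc, ← v_mul, inv_mul_cancel, v_one, mul_one]

/-- The endomorphism `i a * v g ↦ i (γ a) * v (θ g)`. -/
def endo (γ : A →⋆ₙₐ[ℂ] A) (θ : G →* G) (h : ∀ g a, β (θ g) (γ a) = γ (β g a)) :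
    CrossedProduct β →⋆ₙₐ[ℂ] CrossedProduct β := (exists_endo γ θ h).choose

theorem endo_i (γ : A →⋆ₙₐ[ℂ] A) (θ : G →* G) (h : ∀ g a, β (θ g) (γ a) = γ (β g a)) (a : A) :
    endo γ θ h (i β a) = i β (γ a) := (exists_endo γ θ h).choose_spec.1 a

theorem endo_v (γ : A →⋆ₙₐ[ℂ] A) (θ : G →* G) (h : ∀ g a, β (θ g) (γ a) = γ (β g a)) (g : G) :
    endo γ θ h (v β g) = i β (γ 1) * v β (θ g) := (exists_endo γ θ h).choose_spec.2 g

theorem endo_eq_one (γ : A →⋆ₙₐ[ℂ] A) (θ : G →* G) (h : ∀ g a, β (θ g) (γ a) = γ (β g a))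
    (hγ : ∀ a, γ a = a) (hθ : ∀ g, θ g = g) : endo γ θ h = 1 := by
  refine hom_ext (fun a => ?_) (fun g => ?_)
  · rw [endo_i, hγ]; rfl
  · rw [endo_v, hγ, hθ, map_one (i β), one_mul]; rfl

theorem endo_eq_mul (γ γ₁ γ₂ : A →⋆ₙₐ[ℂ] A) (θ θ₁ θ₂ : G →* G)
    (h : ∀ g a, β (θ g) (γ a) = γ (β g a)) (h₁ : ∀ g a, β (θ₁ g) (γ₁ a) = γ₁ (β g a))
    (h₂ : ∀ g a, β (θ₂ g) (γ₂ a) = γ₂ (β g a)) (hγ : ∀ a, γ a = γ₁ (γ₂ a))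
    (hθ : ∀ g, θ g = θ₁ (θ₂ g)) : endo γ θ h = endo γ₁ θ₁ h₁ * endo γ₂ θ₂ h₂ := by
  refine hom_ext (fun a => ?_) (fun g => ?_)
  · change _ = endo γ₁ θ₁ h₁ (endo γ₂ θ₂ h₂ _)
    rw [endo_i, endo_i, endo_i, hγ]
  · change _ = endo γ₁ θ₁ h₁ (endo γ₂ θ₂ h₂ _)
    rw [endo_v, endo_v, map_mul, endo_i, endo_v, hγ, hθ, ← mul_assoc, ← map_mul (i β),
      ← map_mul γ₁, mul_one]

end endo

end CrossedProduct

/-! ## The Toeplitz algebra of the `ax+b`-semigroup -/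

/-- The non-zero ideals of `R`. -/
abbrev NzIdeal (R : Type*) [CommRing R] : Type _ := {I : Ideal R // I ≠ ⊥}

namespace NzIdeal

variable {R : Type*} [CommRing R] [IsDomain R]

/-- The intersection of two non-zero ideals. -/
def inter (I J : NzIdeal R) : NzIdeal R :=
  ⟨I.1 ⊓ J.1, fun h => by
    rcases Ideal.mul_eq_bot.mp (le_bot_iff.mp (Ideal.mul_le_inf.trans h.le)) with h | h
    · exact I.2 h
    · exact J.2 h⟩

/-- The ideal `R`. -/
def whole (R : Type*) [CommRing R] [IsDomain R] : NzIdeal R := ⟨⊤, top_ne_bot⟩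

/-- The ideal `aI`, for `a ≠ 0`. -/
def scale (a : nonZeroDivisors R) (I : NzIdeal R) : NzIdeal R :=
  ⟨Ideal.span {(a : R)} * I.1, fun h => by
    rcases Ideal.mul_eq_bot.mp h with h | h
    · exact nonZeroDivisors.coe_ne_zero a (Ideal.span_singleton_eq_bot.mp h)
    · exact I.2 h⟩

end NzIdeal

/-- The generators `u x` (`x ∈ R`), `s a` (`a ∈ R \ {0}`) and `e I` (`I` a non-zero ideal) of the
Toeplitz algebra. In a domain `nonZeroDivisors R` is the multiplicative semigroup `R \ {0}`. -/
inductive ToeplitzGen (R : Type*) [CommRing R] : Type _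
  | u (x : R)
  | s (a : nonZeroDivisors R)
  | e (I : NzIdeal R)

variable {R : Type*} [CommRing R] [IsDomain R]

namespace Toeplitz

open FreeStarAlg

/-- The defining relations of the Toeplitz algebra. -/
inductive Rel : FreeStarAlg (ToeplitzGen R) → FreeStarAlg (ToeplitzGen R) → Prop
  -- the `u x` are unitary and represent the additive group
  | u_unitary (x : R) : Rel (star (of (.u x)) * of (.u x)) 1
  | u_unitary' (x : R) : Rel (of (.u x) * star (of (.u x))) 1
  | u_add (x y : R) : Rel (of (.u x) * of (.u y)) (of (.u (x + y)))
  -- the `s a` are isometries and represent the multiplicative semigroup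
  | s_isometry (a : nonZeroDivisors R) : Rel (star (of (.s a)) * of (.s a)) 1
  | s_mul (a b : nonZeroDivisors R) : Rel (of (.s a) * of (.s b)) (of (.s (a * b)))
  | s_u (a : nonZeroDivisors R) (x : R) :
      Rel (of (.s a) * of (.u x)) (of (.u (a * x)) * of (.s a))
  -- the `e I` are projections, with `e (I ∩ J) = e I * e J` and `e R = 1`
  | e_star (I : NzIdeal R) : Rel (star (of (.e I))) (of (.e I))
  | e_idem (I : NzIdeal R) : Rel (of (.e I) * of (.e I)) (of (.e I))
  | e_inter (I J : NzIdeal R) : Rel (of (.e (I.inter J))) (of (.e I) * of (.e J))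
  | e_whole : Rel (of (.e (NzIdeal.whole R))) 1
  -- `s a * e I * (s a)* = e (aI)`
  | s_e (a : nonZeroDivisors R) (I : NzIdeal R) :
      Rel (of (.s a) * of (.e I) * star (of (.s a))) (of (.e (I.scale a)))
  -- `u x * e I = e I * u x` if `x ∈ I`, and `e I * u x * e I = 0` if `x ∉ I`
  | u_e_mem (x : R) (I : NzIdeal R) (h : x ∈ I.1) :
      Rel (of (.u x) * of (.e I)) (of (.e I) * of (.u x))
  | u_e_notMem (x : R) (I : NzIdeal R) (h : x ∉ I.1) :
      Rel (of (.e I) * of (.u x) * of (.e I)) 0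

/-- The presentation of the Toeplitz algebra. -/
def presentation (R : Type*) [CommRing R] [IsDomain R] : CStarPresentation (ToeplitzGen R) where
  rel := Rel
  bdd x := by
    cases x with
    | u x => exact ⟨1, fun p hp h => hp.le_one_of_isometry (h _ _ (Rel.u_unitary x))⟩
    | s a => exact ⟨1, fun p hp h => hp.le_one_of_isometry (h _ _ (Rel.s_isometry a))⟩
    | e I => exact ⟨1, fun p hp h =>
        hp.le_one_of_projection (h _ _ (Rel.e_star I)) (h _ _ (Rel.e_idem I))⟩

end Toeplitz

/-- The Toeplitz algebra of the `ax+b`-semigroup over `R`: the universal C*-algebra generated by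
the `u x`, `s a` and `e I` subject to the relations `Toeplitz.Rel`. -/
def Toeplitz (R : Type*) [CommRing R] [IsDomain R] : Type _ := (Toeplitz.presentation R).CStar

namespace Toeplitz

instance : CStarAlgebra (Toeplitz R) := inferInstanceAs (CStarAlgebra (presentation R).CStar)

/-- The unitaries `u x`. -/
def u (x : R) : Toeplitz R := (presentation R).gen (.u x)
/-- The isometries `s a`. -/
def s (a : nonZeroDivisors R) : Toeplitz R := (presentation R).gen (.s a)
/-- The projections `e I`. -/
def e (I : NzIdeal R) : Toeplitz R := (presentation R).gen (.e I)

/-- The images of related elements of the free algebra in the Toeplitz algebra are equal. -/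
theorem eq_of_rel {a b : FreeStarAlg (ToeplitzGen R)} (h : Rel a b) :
    (presentation R).toCStar a = (presentation R).toCStar b :=
  (presentation R).toCStar_eq_of_rel h

theorem star_u_mul_u (x : R) : star (u x) * u x = 1 := by
  have := eq_of_rel (Rel.u_unitary x)
  rwa [map_mul, map_star, map_one] at this

theorem u_mul_u (x y : R) : u x * u y = u (x + y) := by
  have := eq_of_rel (Rel.u_add x y)
  rwa [map_mul] at this

theorem star_s_mul_s (a : nonZeroDivisors R) : star (s a) * s a = 1 := by
  have := eq_of_rel (Rel.s_isometry a)
  rwa [map_mul, map_star, map_one] at this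

theorem s_mul_s (a b : nonZeroDivisors R) : s a * s b = s (a * b) := by
  have := eq_of_rel (Rel.s_mul a b)
  rwa [map_mul] at this

theorem s_mul_u (a : nonZeroDivisors R) (x : R) : s a * u x = u (a * x) * s a := by
  have := eq_of_rel (Rel.s_u a x)
  rwa [map_mul, map_mul] at this

theorem star_e (I : NzIdeal R) : star (e I) = e I := by
  have := eq_of_rel (Rel.e_star I)
  rwa [map_star] at this

theorem e_inter (I J : NzIdeal R) : e (I.inter J) = e I * e J := by
  have := eq_of_rel (Rel.e_inter I J)
  rwa [map_mul] at this

theorem s_mul_e (a : nonZeroDivisors R) (I : NzIdeal R) :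
    s a * e I * star (s a) = e (I.scale a) := by
  have := eq_of_rel (Rel.s_e a I)
  rwa [map_mul, map_mul, map_star] at this

theorem u_mul_e {x : R} {I : NzIdeal R} (h : x ∈ I.1) : u x * e I = e I * u x := by
  have := eq_of_rel (Rel.u_e_mem x I h)
  rwa [map_mul, map_mul] at this

theorem e_mul_u_mul_e {x : R} {I : NzIdeal R} (h : x ∉ I.1) : e I * u x * e I = 0 := by
  have := eq_of_rel (Rel.u_e_notMem x I h)
  rwa [map_mul, map_mul, map_zero] at this

theorem u_zero : u (0 : R) = 1 := by
  calc u (0 : R) = (star (u 0) * u 0) * u 0 := by rw [star_u_mul_u, one_mul]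
    _ = 1 := by rw [mul_assoc, u_mul_u, add_zero, star_u_mul_u]

theorem star_u (x : R) : star (u x) = u (-x) := by
  calc star (u x) = star (u x) * (u x * u (-x)) := by
        rw [u_mul_u, add_neg_cancel, u_zero, mul_one]
    _ = _ := by rw [← mul_assoc, star_u_mul_u, one_mul]

theorem s_one : s (1 : nonZeroDivisors R) = 1 := by
  calc s (1 : nonZeroDivisors R) = (star (s 1) * s 1) * s 1 := by rw [star_s_mul_s, one_mul]
    _ = 1 := by rw [mul_assoc, s_mul_s, mul_one, star_s_mul_s]

/-! ### The canonical commutative subalgebra -/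

/-- The projections `u x * e I * u (-x)`. -/
def ex (x : R) (I : NzIdeal R) : Toeplitz R := u x * e I * u (-x)

theorem ex_zero (I : NzIdeal R) : ex 0 I = e I := by
  rw [ex, neg_zero, u_zero, one_mul, mul_one]

theorem u_conj_ex (y x : R) (I : NzIdeal R) : u y * ex x I * star (u y) = ex (y + x) I := by
  simp only [ex, star_u, ← mul_assoc, u_mul_u]
  rw [mul_assoc, u_mul_u, neg_add_rev]

theorem star_ex (x : R) (I : NzIdeal R) : star (ex x I) = ex x I := by
  rw [ex, star_mul, star_mul, star_e, ← star_u, star_star, mul_assoc]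

theorem s_conj_ex (a : nonZeroDivisors R) (x : R) (I : NzIdeal R) :
    s a * ex x I * star (s a) = ex (a * x) (I.scale a) := by
  have h : u (-x) * star (s a) = star (s a) * u (-(a * x)) := by
    have := congrArg star (s_mul_u a x)
    rwa [star_mul, star_mul, star_u, star_u] at this
  calc s a * ex x I * star (s a) = (s a * u x) * e I * (u (-x) * star (s a)) := by
        simp only [ex, mul_assoc]
    _ = u (a * x) * (s a * e I * star (s a)) * u (-(a * x)) := by
        rw [s_mul_u, h]; simp only [mul_assoc]
    _ = _ := by rw [s_mul_e]; rfl

theorem ex_mul_ex (x y : R) (I J : NzIdeal R) :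
    ex x I * ex y J = u x * (e I * u (y - x) * e J) * u (-y) := by
  have : u (y - x) = u (-x) * u y := by rw [u_mul_u]; congr 1; ring
  simp only [ex, this, mul_assoc]

theorem ex_mul_ex_comm (x y : R) (I J : NzIdeal R) : ex x I * ex y J = ex y J * ex x I := by
  suffices h : star (ex x I * ex y J) = ex x I * ex y J by
    rw [star_mul, star_ex, star_ex] at h
    exact h.symm
  rw [ex_mul_ex]
  by_cases hm : y - x ∈ I.1 ⊔ J.1
  · obtain ⟨i, hi, j, hj, hij⟩ := Submodule.mem_sup.mp hm
    have h1 : u x * (e I * u (y - x) * e J) * u (-y) = ex (x + i) (I.inter J) := by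
      have h2 : -(x + i) = j + -y := by linear_combination -hij
      calc u x * (e I * u (y - x) * e J) * u (-y)
          = u x * ((e I * u i) * (u j * e J)) * u (-y) := by
            rw [← hij, ← u_mul_u]; simp only [mul_assoc]
        _ = (u x * u i) * (e I * e J) * (u j * u (-y)) := by
            rw [← u_mul_e hi, u_mul_e hj]; simp only [mul_assoc]
        _ = ex (x + i) (I.inter J) := by rw [ex, e_inter, h2, u_mul_u, u_mul_u]
    rw [h1, star_ex]
  · let L : NzIdeal R := ⟨I.1 ⊔ J.1, fun h => I.2 (le_bot_iff.mp (le_sup_left.trans h.le))⟩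
    have hI : e I = e I * e L := by
      rw [← e_inter]; congr 1; exact Subtype.ext (inf_eq_left.mpr le_sup_left).symm
    have hJ : e J = e L * e J := by
      rw [← e_inter]; congr 1; exact Subtype.ext (inf_eq_right.mpr le_sup_right).symm
    have h0 : e I * u (y - x) * e J = 0 := by
      calc e I * u (y - x) * e J = e I * (e L * u (y - x) * e L) * e J := by
            rw [hI, hJ]
            simp only [mul_assoc]
            rw [← hJ, ← mul_assoc (e L) (e L), ← e_inter]
            congr 4
            exact Subtype.ext (inf_idem _).symm
        _ = 0 := by rw [e_mul_u_mul_e (I := L) hm, mul_zero, zero_mul]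
    rw [h0, mul_zero, zero_mul, star_zero]

/-- The *-subalgebra generated by the projections `ex x I`, before taking the closure. -/
def DAlg (R : Type*) [CommRing R] [IsDomain R] : StarSubalgebra ℂ (Toeplitz R) :=
  StarAlgebra.adjoin ℂ {d | ∃ x I, d = ex x I}

/-- The canonical commutative subalgebra: the C*-subalgebra generated by the projections
`u x * e I * u (-x)`. -/
def Dbar (R : Type*) [CommRing R] [IsDomain R] : StarSubalgebra ℂ (Toeplitz R) :=
  (DAlg R).topologicalClosure

theorem ex_mem_Dbar (x : R) (I : NzIdeal R) : ex x I ∈ Dbar R :=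
  StarSubalgebra.le_topologicalClosure _ (StarAlgebra.subset_adjoin ℂ _ ⟨x, I, rfl⟩)

instance : IsClosed (Dbar R : Set (Toeplitz R)) := StarSubalgebra.isClosed_topologicalClosure _

theorem Dbar_mul_comm (a b : Dbar R) : a * b = b * a := by
  have h : ∀ x y : DAlg R, x * y = y * x :=
    (StarAlgebra.isMulCommutative_adjoin ℂ
      (by rintro _ ⟨x, I, rfl⟩ _ ⟨y, J, rfl⟩; exact ex_mul_ex_comm x y I J)
      (by rintro _ ⟨x, I, rfl⟩ _ ⟨y, J, rfl⟩; rw [star_ex]; exact ex_mul_ex_comm x y I J)).is_comm.comm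
  exact ((DAlg R).commRingTopologicalClosure h).mul_comm a b

/-- The canonical commutative subalgebra, as a C*-algebra in its own right. -/
def D (R : Type*) [CommRing R] [IsDomain R] : Type _ := Dbar R

/-- The C*-algebra structure of the canonical commutative subalgebra is the one inherited from the
Toeplitz algebra. (It is marked irreducible only to keep elaboration fast.) -/
@[irreducible]
def commCStarAlgebraD (R : Type*) [CommRing R] [IsDomain R] : CommCStarAlgebra (D R) :=
  { (inferInstance : CStarAlgebra (Dbar R)) with mul_comm := Dbar_mul_comm }

instance : CommCStarAlgebra (D R) := commCStarAlgebraD R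

/-- An element of the canonical commutative subalgebra. -/
def mkD (z : Toeplitz R) (hz : z ∈ Dbar R) : D R := (⟨z, hz⟩ : Dbar R)

/-- The inclusion of the canonical commutative subalgebra into the Toeplitz algebra. -/
def incl (R : Type*) [CommRing R] [IsDomain R] : D R →⋆ₐ[ℂ] Toeplitz R where
  toFun d := Subtype.val (show Dbar R from d)
  map_one' := by with_unfolding_all rfl
  map_mul' _ _ := by with_unfolding_all rfl
  map_zero' := by with_unfolding_all rfl
  map_add' _ _ := by with_unfolding_all rfl
  commutes' _ := by with_unfolding_all rfl
  map_star' _ := by with_unfolding_all rfl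

theorem incl_mkD (z : Toeplitz R) (hz : z ∈ Dbar R) : incl R (mkD z hz) = z := rfl

theorem incl_mem (d : D R) : incl R d ∈ Dbar R := Subtype.prop (show Dbar R from d)

theorem incl_injective : Function.Injective (incl R) := fun _ _ h => Subtype.ext h

/-- Conjugation by an isometry that maps generators `ex x I` to such generators preserves the
canonical commutative subalgebra. -/
theorem conj_mem_Dbar (w : Toeplitz R) (hw : star w * w = 1)
    (h : ∀ x I, ∃ y J, w * ex x I * star w = ex y J) {d : Toeplitz R} (hd : d ∈ Dbar R) :
    w * d * star w ∈ Dbar R := by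
  have hgen : ∀ x I, w * ex x I * star w ∈ Dbar R := fun x I => by
    obtain ⟨y, J, hyJ⟩ := h x I
    rw [hyJ]; exact ex_mem_Dbar y J
  have hD : ∀ d ∈ DAlg R, w * d * star w ∈ Dbar R := by
    intro d hd
    induction hd using StarAlgebra.adjoin_induction with
    | mem d hd => obtain ⟨x, I, rfl⟩ := hd; exact hgen x I
    | algebraMap c =>
      have h1 : ex 0 (NzIdeal.whole R) = 1 :=
        (ex_zero _).trans ((eq_of_rel Rel.e_whole).trans (map_one _))
      have h2 := hgen 0 (NzIdeal.whole R)
      rw [h1] at h2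
      rw [Algebra.algebraMap_eq_smul_one, mul_smul_comm, smul_mul_assoc]
      exact (Dbar R).smul_mem h2 c
    | add a b _ _ ha hb => rw [mul_add, add_mul]; exact add_mem ha hb
    | mul a b _ _ ha hb =>
      have : w * (a * b) * star w = (w * a * star w) * (w * b * star w) := by
        calc w * (a * b) * star w = w * a * 1 * b * star w := by simp only [mul_assoc, one_mul]
          _ = _ := by rw [← hw]; simp only [mul_assoc]
      rw [this]; exact mul_mem ha hb
    | star a _ ha =>
      have : w * star a * star w = star (w * a * star w) := by
        simp only [star_mul, star_star, mul_assoc]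
      rw [this]; exact star_mem ha
  have hcl : IsClosed {d : Toeplitz R | w * d * star w ∈ Dbar R} :=
    IsClosed.preimage (f := fun d : Toeplitz R => w * d * star w) (by fun_prop)
      (StarSubalgebra.isClosed_topologicalClosure (DAlg R))
  exact closure_minimal (s := (DAlg R : Set (Toeplitz R))) hD hcl hd

/-- Conjugation `d ↦ w * d * star w` on the canonical commutative subalgebra, for an isometry `w`
for which it maps the generators `ex x I` to such generators. -/
def conjD (w : Toeplitz R) (hw : star w * w = 1)
    (h : ∀ x I, ∃ y J, w * ex x I * star w = ex y J) : D R →⋆ₙₐ[ℂ] D R where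
  toFun d := mkD (w * incl R d * star w) (conj_mem_Dbar w hw h (incl_mem d))
  map_smul' c d := incl_injective <| by
    rw [incl_mkD, map_smul, map_smul, incl_mkD, mul_smul_comm, smul_mul_assoc]
    rfl
  map_zero' := incl_injective <| by
    rw [incl_mkD, map_zero, mul_zero, zero_mul]
  map_add' a b := incl_injective <| by
    rw [incl_mkD, map_add, map_add, incl_mkD, incl_mkD, mul_add, add_mul]
  map_mul' a b := incl_injective <| by
    rw [incl_mkD, map_mul, map_mul, incl_mkD, incl_mkD]
    calc w * (incl R a * incl R b) * star w = w * incl R a * 1 * incl R b * star w := by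
          simp only [mul_assoc, one_mul]
      _ = _ := by rw [← hw]; simp only [mul_assoc]
  map_star' a := incl_injective <| by
    rw [incl_mkD, map_star, map_star, incl_mkD]
    simp only [star_mul, star_star, mul_assoc]

/-- The spectrum `Y_R` of the canonical commutative subalgebra. -/
abbrev Y (R : Type*) [CommRing R] [IsDomain R] : Type _ := WeakDual.characterSpace ℂ (D R)

/-- The Gelfand isomorphism of the canonical commutative subalgebra with `C(Y_R)`. -/
def gelfand (R : Type*) [CommRing R] [IsDomain R] : D R ≃⋆ₐ[ℂ] C(Y R, ℂ) :=
  gelfandStarTransform (D R)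

/-- The endomorphism of `C(Y_R)` that corresponds to an endomorphism of the canonical commutative
subalgebra under the Gelfand isomorphism. -/
def transport (γ : D R →⋆ₙₐ[ℂ] D R) : C(Y R, ℂ) →⋆ₙₐ[ℂ] C(Y R, ℂ) :=
  ((gelfand R : D R →⋆ₙₐ[ℂ] C(Y R, ℂ)).comp γ).comp
    ((gelfand R).symm : C(Y R, ℂ) →⋆ₙₐ[ℂ] D R)

theorem transport_apply (γ : D R →⋆ₙₐ[ℂ] D R) (f : C(Y R, ℂ)) :
    transport γ f = gelfand R (γ ((gelfand R).symm f)) := rfl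

theorem transport_comp (γ δ : D R →⋆ₙₐ[ℂ] D R) (f : C(Y R, ℂ)) :
    transport γ (transport δ f) = gelfand R (γ (δ ((gelfand R).symm f))) := by
  rw [transport_apply, transport_apply, StarAlgEquiv.symm_apply_apply]

/-- The action of `x ∈ R` on the canonical commutative subalgebra: conjugation by `u x`. -/
def conjU (x : R) : D R →⋆ₙₐ[ℂ] D R :=
  conjD (u x) (star_u_mul_u x) fun y I => ⟨x + y, I, u_conj_ex x y I⟩

/-- The action of `a ∈ R \ {0}` on the canonical commutative subalgebra: conjugation by `s a`. -/
def conjS (a : nonZeroDivisors R) : D R →⋆ₙₐ[ℂ] D R :=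
  conjD (s a) (star_s_mul_s a) fun y I => ⟨a * y, I.scale a, s_conj_ex a y I⟩

theorem incl_conjU (x : R) (d : D R) : incl R (conjU x d) = u x * incl R d * star (u x) := rfl

theorem incl_conjS (a : nonZeroDivisors R) (d : D R) :
    incl R (conjS a d) = s a * incl R d * star (s a) := rfl

theorem conjU_add (x y : R) (d : D R) : conjU (x + y) d = conjU x (conjU y d) :=
  incl_injective <| by
    simp only [incl_conjU, ← u_mul_u, star_mul, mul_assoc]

theorem conjU_zero (d : D R) : conjU (0 : R) d = d :=
  incl_injective <| by rw [incl_conjU, u_zero, star_one, one_mul, mul_one]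

theorem conjS_mul (a b : nonZeroDivisors R) (d : D R) :
    conjS (a * b) d = conjS a (conjS b d) :=
  incl_injective <| by
    simp only [incl_conjS, ← s_mul_s, star_mul, mul_assoc]

theorem conjS_one (d : D R) : conjS (1 : nonZeroDivisors R) d = d :=
  incl_injective <| by rw [incl_conjS, s_one, star_one, one_mul, mul_one]

theorem conjU_conjS (a : nonZeroDivisors R) (x : R) (d : D R) :
    conjU (a * x) (conjS a d) = conjS a (conjU x d) :=
  incl_injective <| by
    simp only [incl_conjS, incl_conjU]
    calc u (a * x) * (s a * incl R d * star (s a)) * star (u (a * x))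
        = (u (a * x) * s a) * incl R d * star (u (a * x) * s a) := by
          simp only [star_mul, mul_assoc]
      _ = _ := by rw [← s_mul_u]; simp only [star_mul, mul_assoc]

/-- The action of the additive group `R` on `C(Y_R)`, corresponding to conjugation by the `u x`. -/
def addAct (R : Type*) [CommRing R] [IsDomain R] :
    Multiplicative R →* (C(Y R, ℂ) →⋆ₙₐ[ℂ] C(Y R, ℂ)) where
  toFun x := transport (conjU x.toAdd)
  map_one' := by
    ext1 f
    rw [transport_apply, toAdd_one, conjU_zero, StarAlgEquiv.apply_symm_apply]
    rfl
  map_mul' x y := by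
    ext1 f
    change _ = transport _ (transport _ f)
    rw [transport_comp, transport_apply, toAdd_mul, conjU_add]

/-- Multiplication by `a` on the additive group `R`. -/
def mulHom (a : R) : Multiplicative R →* Multiplicative R :=
  AddMonoidHom.toMultiplicative (AddMonoidHom.mulLeft a)

theorem addAct_transport (a : nonZeroDivisors R) (x : Multiplicative R) (f : C(Y R, ℂ)) :
    addAct R (mulHom (a : R) x) (transport (conjS a) f) = transport (conjS a) (addAct R x f) := by
  change transport (conjU (a * x.toAdd)) _ = transport _ (transport (conjU x.toAdd) f)
  rw [transport_comp, transport_comp, conjU_conjS]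

theorem transport_conjS_one (f : C(Y R, ℂ)) :
    transport (conjS (1 : nonZeroDivisors R)) f = f := by
  rw [transport_apply, conjS_one, StarAlgEquiv.apply_symm_apply]

theorem transport_conjS_mul (a b : nonZeroDivisors R) (f : C(Y R, ℂ)) :
    transport (conjS (a * b)) f = transport (conjS a) (transport (conjS b) f) := by
  rw [transport_comp, transport_apply, conjS_mul]

theorem mulHom_one {T : Type*} [CommRing T] (x : Multiplicative T) :
    mulHom ((1 : nonZeroDivisors T) : T) x = x :=
  congrArg Multiplicative.ofAdd (one_mul x.toAdd)

theorem mulHom_mul {T : Type*} [CommRing T] (a b : nonZeroDivisors T) (x : Multiplicative T) :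
    mulHom ((a * b : nonZeroDivisors T) : T) x = mulHom (a : T) (mulHom (b : T) x) :=
  congrArg Multiplicative.ofAdd (mul_assoc (a : T) (b : T) x.toAdd)

/-- The action of the multiplicative semigroup `R \ {0}` on `C(Y_R) ⋊ R`: the element `a` acts by
conjugation by `s a` on `C(Y_R)`, and sends `f * u x` to `(s a * f * star (s a)) * u (a * x)`. -/
def mulAct (R : Type*) [CommRing R] [IsDomain R] :
    nonZeroDivisors R →* (CrossedProduct (addAct R) →⋆ₙₐ[ℂ] CrossedProduct (addAct R)) where
  toFun a := CrossedProduct.endo (transport (conjS a)) (mulHom (a : R)) (addAct_transport a)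
  map_one' := CrossedProduct.endo_eq_one _ _ _ transport_conjS_one mulHom_one
  map_mul' a b := CrossedProduct.endo_eq_mul _ _ _ _ _ _ _ _ _ (transport_conjS_mul a b)
    (mulHom_mul a b)

end Toeplitz

end

noncomputable section

variable {R : Type*} [CommRing R] [IsDomain R]

namespace Toeplitz

open FreeStarAlg

/-! Both algebras are universal for essentially the same data: a copy of the commutative algebra `D
R`, unitaries indexed by `R` that implement translation on it, and isometries indexed by the
non-zero elements that implement conjugation by `s a`. It is therefore enough to find each set of
generators, with its relations, inside the other algebra. The two resulting homomorphisms are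
mutually inverse because they are so on generators.

The one point where the two sets of relations differ in shape is the interaction of `s a` with `u
x`. The endomorphism attached to `a` is not unital: it sends 1 to the projection of the ideal `aR`,
so covariance in the crossed product only says that conjugating the unitary of `x` by the isometry
of `a` gives that projection times the unitary of `a * x`. The Toeplitz relation is the
stronger-looking `s a * u x = u (a * x) * s a`. The two are equivalent because the projection of
`aR` is the range projection of the isometry, and because `a * x` lies in `aR`, so that its unitary
commutes with this projection. The passage is made in `v_mul_uCrossed` for one direction and in
`s_mul_u_mul_star_s` for the other.

The relations (d) turn into statements inside `D R`: the projection of `I` is fixed by translation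
by elements of `I` and is orthogonal to its translates by all other elements. The relations (b) and
(c) are identities in `D R` carried over by the homomorphism `inclCrossed`.

Finally, the Toeplitz presentation controls the isomorphism only on the projections `e I`.
Covariance gives its values on all translates, and since these generate `D R` as a C*-algebra,
`hom_ext_D` gives the value on every element of `D R`. -/

/-! ### The ideal projections inside the commutative subalgebra -/

theorem e_whole : e (NzIdeal.whole R) = 1 :=
  (eq_of_rel Rel.e_whole).trans (map_one _)

theorem e_mul_e (I : NzIdeal R) : e I * e I = e I := by
  have := eq_of_rel (Rel.e_idem I)
  rwa [map_mul] at this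

theorem e_mem_Dbar (I : NzIdeal R) : e I ∈ Dbar R := ex_zero I ▸ ex_mem_Dbar 0 I

/-- The projection `e I` as an element of the canonical commutative subalgebra. -/
def eD (I : NzIdeal R) : D R := mkD (e I) (e_mem_Dbar I)

theorem incl_eD (I : NzIdeal R) : incl R (eD I) = e I := rfl

theorem eD_inter (I J : NzIdeal R) : eD (I.inter J) = eD I * eD J :=
  incl_injective <| by rw [map_mul, incl_eD, incl_eD, incl_eD, e_inter]

theorem eD_mul_eD (I : NzIdeal R) : eD I * eD I = eD I :=
  incl_injective <| by rw [map_mul, incl_eD, e_mul_e]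

theorem star_eD (I : NzIdeal R) : star (eD I) = eD I :=
  incl_injective <| by rw [map_star, incl_eD, star_e]

theorem eD_whole : eD (NzIdeal.whole R) = 1 :=
  incl_injective <| by rw [map_one, incl_eD, e_whole]

theorem conjS_eD (a : nonZeroDivisors R) (I : NzIdeal R) : conjS a (eD I) = eD (I.scale a) :=
  incl_injective <| by rw [incl_conjS, incl_eD, incl_eD, s_mul_e]

/-- Identifies the generators `ex x I` of the commutative subalgebra with the translates of the `eD
I`, so that they can be handled through the action alone. -/
theorem incl_conjU_eD (x : R) (I : NzIdeal R) : incl R (conjU x (eD I)) = ex x I := by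
  rw [incl_conjU, incl_eD, ex, star_u]

/-- The first half of relation (d), rewritten as an invariance inside `D R`. -/
theorem conjU_eD_of_mem {x : R} {I : NzIdeal R} (h : x ∈ I.1) : conjU x (eD I) = eD I :=
  incl_injective <| by
    rw [incl_conjU, incl_eD, u_mul_e h, mul_assoc, star_u, u_mul_u, add_neg_cancel, u_zero, mul_one]

/-- The second half of relation (d): multiplying `e I * u x * e I = 0` on the right by `u (-x)`
makes it an orthogonality of two elements of `D R`. -/
theorem eD_mul_conjU_eD_of_notMem {x : R} {I : NzIdeal R} (h : x ∉ I.1) :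
    eD I * conjU x (eD I) = 0 :=
  incl_injective <| by
    rw [map_mul, incl_conjU_eD, incl_eD, map_zero, ex, ← mul_assoc, ← mul_assoc,
      e_mul_u_mul_e h, zero_mul]

/-- Relation (c) for the ideal `R`: the image of the unit is the range projection `s a * star (s
a)`. It measures how far `conjS a` is from being unital. -/
theorem conjS_one_eq_eD (a : nonZeroDivisors R) :
    conjS a (1 : D R) = eD ((NzIdeal.whole R).scale a) := by
  rw [← eD_whole, conjS_eD]

/-- With relation (d), this is what makes the unitary of `a * x` commute with the range projection
of the isometry of `a`. -/
theorem mul_mem_scale_whole (a : nonZeroDivisors R) (x : R) :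
    (a : R) * x ∈ ((NzIdeal.whole R).scale a).1 :=
  Ideal.mul_mem_mul (Ideal.mem_span_singleton_self _) Submodule.mem_top

/-! ### Uniqueness on the commutative subalgebra and existence on the Toeplitz algebra -/

/-- The canonical commutative subalgebra is generated by the projections `ex x I`: unital
*-homomorphisms from it that agree on them are equal. -/
theorem hom_ext_D {B : Type*} [CStarAlgebra B] {φ ψ : D R →⋆ₐ[ℂ] B}
    (h : ∀ x I, φ (conjU x (eD I)) = ψ (conjU x (eD I))) : φ = ψ := by
  have hφ : Continuous φ :=
    CStarPresentation.continuous_starHom (φ : D R →⋆ₙₐ[ℂ] B)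
  have hψ : Continuous ψ :=
    CStarPresentation.continuous_starHom (ψ : D R →⋆ₙₐ[ℂ] B)
  let E : StarSubalgebra ℂ (D R) := StarAlgHom.equalizer φ ψ
  have hE : IsClosed (E : Set (D R)) := isClosed_eq hφ hψ
  -- An injective *-homomorphism of C*-algebras is isometric, so the image of the closed equalizer
  -- `E` is closed in the Toeplitz algebra. Being a *-subalgebra that contains every `ex x I`, this
  -- image contains `Dbar R`.
  have hincl : Isometry (incl R) :=
    AddMonoidHomClass.isometry_of_norm _ (NonUnitalStarAlgHom.norm_map _ incl_injective)
  have hle : Dbar R ≤ E.map (incl R) := by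
    refine StarSubalgebra.topologicalClosure_minimal ?_
      (hincl.isClosedEmbedding.isClosedMap _ hE)
    refine StarAlgebra.adjoin_le ?_
    rintro _ ⟨x, I, rfl⟩
    exact ⟨conjU x (eD I), h x I, incl_conjU_eD x I⟩
  ext d
  obtain ⟨d', hd', hdd'⟩ := hle (incl_mem d)
  obtain rfl := incl_injective hdd'
  exact hd'

/-- The universal property of the Toeplitz algebra. -/
theorem exists_lift {B : Type*} [CStarAlgebra B] (U : R → B) (S : nonZeroDivisors R → B)
    (E : NzIdeal R → B) (hU : ∀ x, star (U x) * U x = 1) (hU' : ∀ x, U x * star (U x) = 1)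
    (hadd : ∀ x y, U x * U y = U (x + y)) (hS : ∀ a, star (S a) * S a = 1)
    (hmul : ∀ a b, S a * S b = S (a * b)) (hSU : ∀ a x, S a * U x = U (a * x) * S a)
    (hstar : ∀ I, star (E I) = E I) (hidem : ∀ I, E I * E I = E I)
    (hinter : ∀ I J, E (I.inter J) = E I * E J) (hwhole : E (NzIdeal.whole R) = 1)
    (hSE : ∀ a I, S a * E I * star (S a) = E (I.scale a))
    (hmem : ∀ x I, x ∈ I.1 → U x * E I = E I * U x)
    (hnot : ∀ x I, x ∉ I.1 → E I * U x * E I = 0) :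
    ∃ Φ : Toeplitz R →⋆ₐ[ℂ] B,
      (∀ x, Φ (u x) = U x) ∧ (∀ a, Φ (s a) = S a) ∧ ∀ I, Φ (e I) = E I := by
  let φ : FreeStarAlg (ToeplitzGen R) →⋆ₐ[ℂ] B := FreeStarAlg.lift fun x =>
    match x with
    | .u x => U x
    | .s a => S a
    | .e I => E I
  have φu : ∀ x, φ (of (.u x)) = U x := fun x => FreeStarAlg.lift_of _ _
  have φs : ∀ a, φ (of (.s a)) = S a := fun a => FreeStarAlg.lift_of _ _
  have φe : ∀ I, φ (of (.e I)) = E I := fun I => FreeStarAlg.lift_of _ _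
  obtain ⟨Φ, hΦ⟩ := (presentation R).exists_lift (φ : FreeStarAlg (ToeplitzGen R) →⋆ₙₐ[ℂ] B) (by
    intro a b hab
    change φ a = φ b
    cases hab with
    | u_unitary x => rw [map_mul, map_star, map_one, φu, hU]
    | u_unitary' x => rw [map_mul, map_star, map_one, φu, hU']
    | u_add x y => rw [map_mul, φu, φu, φu, hadd]
    | s_isometry a => rw [map_mul, map_star, map_one, φs, hS]
    | s_mul a b => rw [map_mul, φs, φs, φs, hmul]
    | s_u a x => rw [map_mul, map_mul, φs, φu, φu, hSU]
    | e_star I => rw [map_star, φe, hstar]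
    | e_idem I => rw [map_mul, φe, hidem]
    | e_inter I J => rw [map_mul, φe, φe, φe, hinter]
    | e_whole => rw [φe, map_one, hwhole]
    | s_e a I => rw [map_mul, map_mul, map_star, φs, φe, φe, hSE]
    | u_e_mem x I h => rw [map_mul, map_mul, φu, φe, hmem x I h]
    | u_e_notMem x I h => rw [map_mul, map_mul, map_zero, φu, φe, hnot x I h])
  -- The universal property of a presentation yields a *-homomorphism that need not be unital; here
  -- it extends the unital `φ`, which fixes its value at 1.
  have h1 : Φ 1 = 1 := by
    have := hΦ 1
    rw [map_one] at this
    exact this.trans (map_one φ)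
  exact ⟨{ Φ with
      map_one' := h1
      commutes' := fun c => by
        change Φ (algebraMap ℂ _ c) = _
        rw [Algebra.algebraMap_eq_smul_one, Algebra.algebraMap_eq_smul_one, map_smul]
        exact congrArg (c • ·) h1 },
    fun x => (hΦ _).trans (φu x), fun a => (hΦ _).trans (φs a), fun I => (hΦ _).trans (φe I)⟩

/-! ### The Toeplitz generators inside the iterated crossed product -/

/-- The image of `D R` in the iterated crossed product. -/
def inclCrossed (R : Type*) [CommRing R] [IsDomain R] :
    D R →⋆ₐ[ℂ] CrossedProduct (mulAct R) :=
  ((CrossedProduct.i (mulAct R)).comp (CrossedProduct.i (addAct R))).comp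
    (gelfand R : D R →⋆ₐ[ℂ] C(Y R, ℂ))

theorem inclCrossed_apply (d : D R) : inclCrossed R d =
    CrossedProduct.i (mulAct R) (CrossedProduct.i (addAct R) (gelfand R d)) := rfl

/-- The image of the unitary `v x` in the iterated crossed product. -/
def uCrossed (x : R) : CrossedProduct (mulAct R) :=
  CrossedProduct.i (mulAct R) (CrossedProduct.v (addAct R) (Multiplicative.ofAdd x))

theorem uCrossed_mul_uCrossed (x y : R) : uCrossed x * uCrossed y = uCrossed (x + y) := by
  rw [uCrossed, uCrossed, uCrossed, ← map_mul, ← CrossedProduct.v_mul, ofAdd_add]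

theorem uCrossed_zero : uCrossed (0 : R) = 1 := by
  rw [uCrossed, ofAdd_zero, CrossedProduct.v_one, map_one]

theorem star_uCrossed (x : R) : star (uCrossed x) = uCrossed (-x) := by
  rw [uCrossed, uCrossed, ← map_star, CrossedProduct.v_star, ofAdd_neg]

theorem star_uCrossed_mul_uCrossed (x : R) : star (uCrossed x) * uCrossed x = 1 := by
  rw [star_uCrossed, uCrossed_mul_uCrossed, neg_add_cancel, uCrossed_zero]

theorem uCrossed_mul_star_uCrossed (x : R) : uCrossed x * star (uCrossed x) = 1 := by
  rw [star_uCrossed, uCrossed_mul_uCrossed, add_neg_cancel, uCrossed_zero]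

theorem gelfand_surjective (f : C(Y R, ℂ)) : ∃ d, gelfand R d = f :=
  ⟨(gelfand R).symm f, (gelfand R).apply_symm_apply f⟩

/-- Every function on the spectrum is a Gelfand transform, so this rule lets the actions be computed
in `D R` rather than on functions. -/
theorem transport_gelfand (γ : D R →⋆ₙₐ[ℂ] D R) (d : D R) :
    transport γ (gelfand R d) = gelfand R (γ d) := by
  rw [transport_apply, StarAlgEquiv.symm_apply_apply]

theorem addAct_gelfand (x : R) (d : D R) :
    addAct R (Multiplicative.ofAdd x) (gelfand R d) = gelfand R (conjU x d) :=
  transport_gelfand _ d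

theorem mulAct_i (a : nonZeroDivisors R) (f : C(Y R, ℂ)) :
    mulAct R a (CrossedProduct.i (addAct R) f) =
      CrossedProduct.i (addAct R) (transport (conjS a) f) :=
  CrossedProduct.endo_i _ _ (addAct_transport a) f

/-- The factor in front is the transform of the projection of `aR`; it appears because an
endomorphism that sends 1 to a proper projection cannot send a unitary to a unitary. -/
theorem mulAct_v (a : nonZeroDivisors R) (x : Multiplicative R) :
    mulAct R a (CrossedProduct.v (addAct R) x) =
      CrossedProduct.i (addAct R) (transport (conjS a) 1) *
        CrossedProduct.v (addAct R) (mulHom (a : R) x) :=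
  CrossedProduct.endo_v _ _ (addAct_transport a) x

theorem uCrossed_conj_inclCrossed (x : R) (d : D R) :
    uCrossed x * inclCrossed R d * star (uCrossed x) = inclCrossed R (conjU x d) := by
  rw [uCrossed, inclCrossed_apply, inclCrossed_apply, ← map_star, ← map_mul, ← map_mul,
    CrossedProduct.covariant, addAct_gelfand]

theorem uCrossed_mul_inclCrossed (x : R) (d : D R) :
    uCrossed x * inclCrossed R d = inclCrossed R (conjU x d) * uCrossed x := by
  rw [← uCrossed_conj_inclCrossed, mul_assoc, star_uCrossed_mul_uCrossed, mul_one]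

theorem v_conj_inclCrossed (a : nonZeroDivisors R) (d : D R) :
    CrossedProduct.v (mulAct R) a * inclCrossed R d * star (CrossedProduct.v (mulAct R) a) =
      inclCrossed R (conjS a d) := by
  rw [inclCrossed_apply, inclCrossed_apply, CrossedProduct.covariant, mulAct_i, transport_gelfand]

/-- Covariance gives the relation only after right multiplication by the adjoint of the isometry,
and with an extra range projection. That projection commutes with the unitary of `a * x` because `a
* x` lies in `aR`, and it is absorbed by the isometry once the latter is multiplied back on the
right. -/
theorem v_mul_uCrossed (a : nonZeroDivisors R) (x : R) :
    CrossedProduct.v (mulAct R) a * uCrossed x =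
      uCrossed (a * x) * CrossedProduct.v (mulAct R) a := by
  -- Covariance at `d = 1` identifies the image of `conjS a 1` with the range projection of the
  -- isometry, which fixes that isometry.
  have hP : inclCrossed R (conjS a 1) * CrossedProduct.v (mulAct R) a =
      CrossedProduct.v (mulAct R) a := by
    rw [← v_conj_inclCrossed, map_one, mul_one, mul_assoc, CrossedProduct.star_v_mul_v, mul_one]
  have hcov : CrossedProduct.v (mulAct R) a * uCrossed x * star (CrossedProduct.v (mulAct R) a) =
      inclCrossed R (conjS a 1) * uCrossed (a * x) := by
    rw [uCrossed, CrossedProduct.covariant, mulAct_v, map_mul, ← map_one (gelfand R),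
      transport_gelfand]
    rfl
  have hcomm : inclCrossed R (conjS a 1) * uCrossed (a * x) =
      uCrossed (a * x) * inclCrossed R (conjS a 1) := by
    rw [uCrossed_mul_inclCrossed, conjS_one_eq_eD, conjU_eD_of_mem (mul_mem_scale_whole a x)]
  calc CrossedProduct.v (mulAct R) a * uCrossed x
      = CrossedProduct.v (mulAct R) a * uCrossed x * star (CrossedProduct.v (mulAct R) a) *
          CrossedProduct.v (mulAct R) a := by
        rw [mul_assoc _ (star _), CrossedProduct.star_v_mul_v, mul_one]
    _ = _ := by rw [hcov, hcomm, mul_assoc, hP]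

/-! ### From the Toeplitz algebra to the crossed product -/

variable (R) in
/-- The canonical *-homomorphism from the Toeplitz algebra to the iterated crossed product. -/
theorem exists_toCrossed : ∃ Φ : Toeplitz R →⋆ₐ[ℂ] CrossedProduct (mulAct R),
    (∀ x, Φ (u x) = uCrossed x) ∧ (∀ a, Φ (s a) = CrossedProduct.v (mulAct R) a) ∧
      ∀ d, Φ (incl R d) = inclCrossed R d := by
  obtain ⟨Φ, hu, hs, he⟩ := exists_lift (R := R) uCrossed (CrossedProduct.v (mulAct R))
    (fun I => inclCrossed R (eD I)) star_uCrossed_mul_uCrossed uCrossed_mul_star_uCrossed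
    uCrossed_mul_uCrossed (CrossedProduct.star_v_mul_v _)
    (fun a b => (CrossedProduct.v_mul _ a b).symm) v_mul_uCrossed
    (fun I => by rw [← map_star, star_eD]) (fun I => by rw [← map_mul, eD_mul_eD])
    (fun I J => by rw [← map_mul, eD_inter]) (by rw [eD_whole, map_one])
    (fun a I => by rw [v_conj_inclCrossed, conjS_eD])
    (fun x I h => by rw [uCrossed_mul_inclCrossed, conjU_eD_of_mem h])
    -- Moving the unitary to the right past the second projection replaces that projection by its
    -- translate, which is orthogonal to the first.
    (fun x I h => by
      rw [mul_assoc, uCrossed_mul_inclCrossed, ← mul_assoc, ← map_mul,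
        eD_mul_conjU_eD_of_notMem h, map_zero, zero_mul])
  refine ⟨Φ, hu, hs, fun d => ?_⟩
  -- So far `Φ` is known only on `u x`, `s a` and `e I`. Conjugating by the unitaries gives its
  -- values on the translates of the `e I`, which determine it on `D R`.
  have key : Φ.comp (incl R) = inclCrossed R := hom_ext_D fun x I => by
    change Φ (incl R (conjU x (eD I))) = _
    rw [incl_conjU, map_mul, map_mul, map_star, hu, incl_eD, he, uCrossed_conj_inclCrossed]
  exact DFunLike.congr_fun key d

/-! ### From the crossed product to the Toeplitz algebra -/

/-- Conjugation by an isometry, as a non-unital *-homomorphism. -/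
def conjIsometry {B : Type*} [CStarAlgebra B] (w : B) (hw : star w * w = 1) : B →⋆ₙₐ[ℂ] B where
  toFun b := w * b * star w
  map_smul' c b := by rw [mul_smul_comm, smul_mul_assoc]; rfl
  map_zero' := by rw [mul_zero, zero_mul]
  map_add' a b := by rw [mul_add, add_mul]
  map_mul' a b := by
    calc w * (a * b) * star w = w * a * 1 * b * star w := by simp only [mul_assoc, one_mul]
      _ = _ := by rw [← hw]; simp only [mul_assoc]
  map_star' a := by simp only [star_mul, star_star, mul_assoc]

/-- The converse passage to `v_mul_uCrossed`: moving `u x` to the left past `s a` leaves `u (a * x)`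
times the range projection of `s a`, and the two factors commute. This is covariance of the pair at
the unitary of `x`. -/
theorem s_mul_u_mul_star_s (a : nonZeroDivisors R) (x : R) :
    s a * u x * star (s a) = incl R (conjS a 1) * u (a * x) := by
  have h : u (a * x) * e ((NzIdeal.whole R).scale a) = e ((NzIdeal.whole R).scale a) * u (a * x) :=
    u_mul_e (mul_mem_scale_whole a x)
  rw [conjS_one_eq_eD, incl_eD, ← h, ← s_mul_e, e_whole, mul_one, s_mul_u, mul_assoc]

variable (R) in
/-- The canonical *-homomorphism from the inner crossed product to the Toeplitz algebra. -/
theorem exists_ofInnerCrossed : ∃ Ψ : CrossedProduct (addAct R) →⋆ₙₐ[ℂ] Toeplitz R,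
    (∀ d, Ψ (CrossedProduct.i (addAct R) (gelfand R d)) = incl R d) ∧
      ∀ x : R, Ψ (CrossedProduct.v (addAct R) (Multiplicative.ofAdd x)) = u x := by
  let π : C(Y R, ℂ) →⋆ₐ[ℂ] Toeplitz R :=
    (incl R).comp ((gelfand R).symm : C(Y R, ℂ) →⋆ₐ[ℂ] D R)
  have hπ : ∀ d, π (gelfand R d) = incl R d := fun d =>
    congrArg (incl R) ((gelfand R).symm_apply_apply d)
  have hπ1 : (π : C(Y R, ℂ) →⋆ₙₐ[ℂ] Toeplitz R) 1 = 1 := map_one π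
  obtain ⟨Ψ, hi, hv⟩ := CrossedProduct.exists_lift (α := addAct R)
    (π : C(Y R, ℂ) →⋆ₙₐ[ℂ] Toeplitz R) (fun x => u x.toAdd)
    (fun x y => by rw [toAdd_mul, u_mul_u]) (fun x => star_u_mul_u _)
    (fun x f => by
      obtain ⟨d, rfl⟩ := gelfand_surjective f
      change _ * π _ * _ = π _
      rw [← ofAdd_toAdd x, addAct_gelfand, hπ, hπ, incl_conjU, toAdd_ofAdd])
    -- Since `π` is unital, the commutation requirement is empty, and the factor `π 1` in the values
    -- of the lift disappears.
    (fun x => by rw [hπ1]; exact Commute.one_left _)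
  exact ⟨Ψ, fun d => (hi _).trans (hπ d), fun x => (hv _).trans (by rw [hπ1, one_mul, toAdd_ofAdd])⟩

variable (R) in
/-- The canonical *-homomorphism from the iterated crossed product to the Toeplitz algebra. -/
theorem exists_ofCrossed : ∃ Ψ : CrossedProduct (mulAct R) →⋆ₙₐ[ℂ] Toeplitz R,
    (∀ x, Ψ (uCrossed x) = u x) ∧ (∀ a, Ψ (CrossedProduct.v (mulAct R) a) = s a) ∧
      ∀ d, Ψ (inclCrossed R d) = incl R d := by
  obtain ⟨π, hd, hu⟩ := exists_ofInnerCrossed R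
  have hπ1 : π 1 = 1 := by
    have := hd 1
    rwa [map_one (gelfand R), map_one (CrossedProduct.i _), map_one (incl R)] at this
  -- Covariance is needed at every element of the inner crossed product. Both sides are
  -- *-homomorphisms in that element, the left one because `s a` is an isometry, so functions and
  -- canonical unitaries suffice.
  have hcov : ∀ a, (conjIsometry (s a) (star_s_mul_s a)).comp π = π.comp (mulAct R a) := by
    refine fun a => CrossedProduct.hom_ext (fun f => ?_) (fun x => ?_)
    · obtain ⟨d, rfl⟩ := gelfand_surjective f
      change s a * π _ * star (s a) = π (mulAct R a _)
      rw [mulAct_i, transport_gelfand, hd, hd, incl_conjS]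
    · change s a * π _ * star (s a) = π (mulAct R a _)
      rw [mulAct_v, map_mul, ← map_one (gelfand R), transport_gelfand, hd, ← ofAdd_toAdd x, hu,
        s_mul_u_mul_star_s]
      exact congrArg _ (hu _).symm
  obtain ⟨Ψ, hi, hv⟩ := CrossedProduct.exists_lift (α := mulAct R) π s
    (fun a b => (s_mul_s a b).symm) star_s_mul_s (fun a z => DFunLike.congr_fun (hcov a) z)
    (fun a => by rw [hπ1]; exact Commute.one_left _)
  exact ⟨Ψ, fun x => (hi _).trans (hu x), fun a => (hv a).trans (by rw [hπ1, one_mul]),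
    fun d => (hi _).trans (hd d)⟩

/-! ### The two homomorphisms are mutually inverse -/

variable (R) in
/-- The Toeplitz algebra is canonically isomorphic to the iterated crossed product. -/
theorem exists_equivCrossed : ∃ Φ : Toeplitz R ≃⋆ₐ[ℂ] CrossedProduct (mulAct R),
    (∀ x, Φ (u x) = uCrossed x) ∧ (∀ a, Φ (s a) = CrossedProduct.v (mulAct R) a) ∧
      ∀ d, Φ (incl R d) = inclCrossed R d := by
  obtain ⟨Φ, Φu, Φs, Φd⟩ := exists_toCrossed R
  obtain ⟨Ψ, Ψu, Ψs, Ψd⟩ := exists_ofCrossed R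
  have hΨΦ : Ψ.comp (Φ : Toeplitz R →⋆ₙₐ[ℂ] CrossedProduct (mulAct R)) =
      NonUnitalStarAlgHom.id ℂ (Toeplitz R) := by
    refine (presentation R).hom_ext ?_ fun x => ?_
    · change Ψ (Φ 1) = 1
      rw [← map_one (incl R), Φd, Ψd]
    · cases x with
      | u x => change Ψ (Φ (u x)) = u x; rw [Φu, Ψu]
      | s a => change Ψ (Φ (s a)) = s a; rw [Φs, Ψs]
      | e I => change Ψ (Φ (e I)) = e I; rw [← incl_eD, Φd, Ψd]
  -- Uniqueness is applied once per layer of the crossed product: first on the image of the inner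
  -- one, whose generators are functions and unitaries, then on the outer one, where only the
  -- isometries remain to be checked.
  have hinner : (((Φ : Toeplitz R →⋆ₙₐ[ℂ] CrossedProduct (mulAct R)).comp Ψ).comp
      (CrossedProduct.i (mulAct R) : CrossedProduct (addAct R) →⋆ₙₐ[ℂ] _)) =
      (CrossedProduct.i (mulAct R) : CrossedProduct (addAct R) →⋆ₙₐ[ℂ] _) := by
    refine CrossedProduct.hom_ext (fun f => ?_) (fun x => ?_)
    · obtain ⟨d, rfl⟩ := gelfand_surjective f
      change Φ (Ψ (inclCrossed R d)) = inclCrossed R d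
      rw [Ψd, Φd]
    · change Φ (Ψ (uCrossed x.toAdd)) = uCrossed x.toAdd
      rw [Ψu, Φu]
  have hΦΨ : (Φ : Toeplitz R →⋆ₙₐ[ℂ] CrossedProduct (mulAct R)).comp Ψ =
      NonUnitalStarAlgHom.id ℂ (CrossedProduct (mulAct R)) := by
    refine CrossedProduct.hom_ext (fun z => DFunLike.congr_fun hinner z) (fun a => ?_)
    change Φ (Ψ (CrossedProduct.v (mulAct R) a)) = CrossedProduct.v (mulAct R) a
    rw [Ψs, Φs]
  exact ⟨{ Φ with
      invFun := Ψ
      left_inv := DFunLike.congr_fun hΨΦ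
      right_inv := DFunLike.congr_fun hΦΨ
      map_smul' := map_smul Φ }, Φu, Φs, Φd⟩

end Toeplitz

end

/-- The value on each `e I` is the case where `d` is `Toeplitz.eD I`, whose image under the
inclusion is `e I`. The right-hand sides are `uCrossed` and `inclCrossed` unfolded. -/
theorem corollary4p17 (K : Type*) [Field K] [NumberField K] :
    ∃ Φ : Toeplitz (NumberField.RingOfIntegers K) ≃⋆ₐ[ℂ]
        CrossedProduct (Toeplitz.mulAct (NumberField.RingOfIntegers K)),
      (∀ x : NumberField.RingOfIntegers K, Φ (Toeplitz.u x) =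
        CrossedProduct.i (Toeplitz.mulAct (NumberField.RingOfIntegers K))
          (CrossedProduct.v (Toeplitz.addAct (NumberField.RingOfIntegers K))
            (Multiplicative.ofAdd x))) ∧
      (∀ a : nonZeroDivisors (NumberField.RingOfIntegers K), Φ (Toeplitz.s a) =
        CrossedProduct.v (Toeplitz.mulAct (NumberField.RingOfIntegers K)) a) ∧
      (∀ d : Toeplitz.D (NumberField.RingOfIntegers K),
        Φ (Toeplitz.incl (NumberField.RingOfIntegers K) d) =
          CrossedProduct.i (Toeplitz.mulAct (NumberField.RingOfIntegers K))
            (CrossedProduct.i (Toeplitz.addAct (NumberField.RingOfIntegers K))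
              (Toeplitz.gelfand (NumberField.RingOfIntegers K) d))) := by
  exact Toeplitz.exists_equivCrossed (NumberField.RingOfIntegers K)
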